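/- Let $K$ be a henselian field, i.e. a field equipped with a nontrivial valuation $v$ whose valuation ring is henselian, and let $p$ be the characteristic exponent of $K$ (so $p=\operatorname{char}K$ if this is positive, and $p=1$ otherwise). For $n<\omega$ write $K^{(p^n)}=\{x^{p^n}\mid x\in K\}$. Fix an enumeration $(f_i)_{i<\omega}$ of all polynomials over the prime field of $K$ in the variables $X_0,X_1,X_2,\dots$, arranged so that $f_i$ involves at most the variables $X_0,\dots,X_{i-1}$. For a subset $X\subseteq K$ and $m<\omega$ let $$(X)_m=\left\{\frac{f_j(\mathbf b)}{f_i(\mathbf a)}\;\middle|\;\mathbf a=(a_l)_{l<m},\ \mathbf b=(b_l)_{l<m}\in X^m,\ i,j<m,\ f_i(\mathbf a)\neq 0\right\}.$$ (If $X\neq\emptyset$, the union of the sets $(X)_m$ is the subfield of $K$ generated by $X$.) Let $\phi(x;\mathbf y)$ be an existential formula in the language of rings, let $\mathbf q$ be a finite tuple of parameters from $K$, and suppose that $X=\phi(K;\mathbf q)$, the subset of $K$ defined by $\phi(x;\mathbf q)$, is infinite. Then there exist $m,n<\omega$ such that $$K^{(p^n)}\subseteq (X)_m.$$ -/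

import Mathlib

/-- `f₀, f₁, f₂, …` enumerates (possibly with repetitions) all polynomials over the prime field
of `K` in the variables `X₀, X₁, X₂, …`, arranged so that `fᵢ` involves at most the variables
`X₀, …, X_{i-1}`. -/
structure IsPolynomialEnumeration (K : Type*) [Field K]
    (f : ℕ → MvPolynomial ℕ (⊥ : Subfield K)) : Prop where
  surjective : Function.Surjective f
  vars_lt : ∀ i, ∀ k ∈ (f i).vars, k < i

/-- The subset `φ(K; q)` of `K` defined in `K` by a formula `φ(x; y)` of the language of rings
and a tuple `q` of parameters, substituted for `y = (y₀, …, y_{k-1})`. -/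
def definedSet {K : Type*} [Field K] [FirstOrder.Ring.CompatibleRing K] {k : ℕ}
    (φ : FirstOrder.Language.ring.Formula (Unit ⊕ Fin k)) (q : Fin k → K) : Set K :=
  {x | φ.Realize (Sum.elim (fun _ => x) q)}

/-- The `m`-th piece `(X)_m` of the subfield generated by `X`: all `x` for which there are tuples
`a, b` of length `m` from `X` and indices `i, j < m` with `x * fᵢ(a) = fⱼ(b)` and `fᵢ(a) ≠ 0`.
The tuples are written as sequences of which only the first `m` terms matter, because `fᵢ` and
`fⱼ` involve only variables of index less than `m`. -/
def fieldPiece {K : Type*} [Field K] (f : ℕ → MvPolynomial ℕ (⊥ : Subfield K))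
    (X : Set K) (m : ℕ) : Set K :=
  {x | ∃ a b : ℕ → K, (∀ l < m, a l ∈ X) ∧ (∀ l < m, b l ∈ X) ∧
    ∃ i < m, ∃ j < m,
      x * MvPolynomial.aeval a (f i) = MvPolynomial.aeval b (f j) ∧
        MvPolynomial.aeval a (f i) ≠ 0}

/-!
Every `p ^ n`-th power of `K` is a rational expression, of a fixed shape, in elements of the
infinite existentially definable set `X`.  The valuation enters through a topological argument.

*Generic points.*  Let `U` be an ultrafilter on `X` without finite sets, and let `x` be the class of
the inclusion `X → K` in the ultrapower of `K` along `U`.  It is transcendental over `K`.  Let `F`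
be the field generated over `K` by `x` and by generic witnesses for the existential quantifiers.

*Separability.*  The extension `F / K` is finitely generated, and the Frobenius of `F` preserves
linear independence over `K`, so `F / K` has a separating transcendence basis.  For the largest `n`
such that `x` is a `K`-combination of `q`-th powers of `F`, `q = p ^ n`, every expansion
`x = ∑ z_i v_i ^ q` contains a `v_i` that is a member of a separating transcendence basis
(`exists_pow_expansion_separating`).  By `exists_frobenius_basis` one can take for `z` products of
elements of `X` that form a basis, over the field of `q`-th powers, of a ring.

*Nearby points.*  Evaluation at the base points makes the ring of germs of continuous functions,
spread out along `U`, a henselian local ring `NearbyGerm` with residue field the ultrapower.  Simple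
roots move continuously over a henselian valued field (`Valued.exists_tendsto_root`), and this is
where the henselian property of `K` is used.  Hensel's lemma in several variables
(`HenselianLocalRing.exists_root_of_isUnit_det`) provides homomorphisms `θ_k` from `F` to this ring
that lift the inclusion of `F` into the ultrapower and satisfy `∑ z_k θ_k(x) = ∑ z_l Y_l ^ q` for
arbitrary coordinates `Y_l` near the base point (`exists_lifts`).  The Jacobian is invertible
because the `z_k` are the basis of a ring and remain independent over the `q`-th powers of the
ultrapower.
A lift of the inclusion carries solutions of polynomial equations and inequations to nearby
solutions, so that the values of `θ_k(x)` lie in `X`.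

*Difference quotients.*  Hence near some point `y₀` all values of the additive polynomial
`P(y) = ∑ z_l y_l ^ q` are of the form `∑ z_k x_k` with `x_k ∈ X`.  If `∑ z_l e_l ^ q = 1`, then
`c ^ q = (P(y₀ + ε c e) - P(y₀)) / (P(y₀ + ε e) - P(y₀))` for all `c` and all small `ε ≠ 0`
(`exists_range_pow_subset_fieldPiece`).
-/

open Polynomial Filter Topology
open scoped IntermediateField nonZeroDivisors

/-! ### Continuity of simple roots -/

/-- The polynomial `Z ^ n + Z ^ (n - 1) + ∑ e k * Z ^ (n - k)` reduces to `Z ^ (n - 1) * (Z + 1)`,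
and the simple root `-1` of its reduction lifts. -/
theorem HenselianLocalRing.exists_root_near_neg_one {R : Type*} [CommRing R]
    [HenselianLocalRing R] (n : ℕ) (e : ℕ → R)
    (he : ∀ k ∈ Finset.Icc 2 n, e k ∈ IsLocalRing.maximalIdeal R) (hn : 2 ≤ n) :
    ∃ z : R, z ^ n + z ^ (n - 1) + ∑ k ∈ Finset.Icc 2 n, e k * z ^ (n - k) = 0 ∧
      IsUnit z := by
  obtain ⟨n, rfl⟩ := Nat.exists_eq_add_of_le' hn
  set Q : R[X] := ∑ k ∈ Finset.Icc 2 (n + 2), C (e k) * X ^ (n + 2 - k) with hQ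
  have hQdeg : Q.degree < ((n + 1 : ℕ) : WithBot ℕ) := by
    refine (degree_sum_le _ _).trans_lt ((Finset.sup_lt_iff (WithBot.bot_lt_coe _)).2 ?_)
    intro k hk
    refine (degree_C_mul_X_pow_le _ _).trans_lt ?_
    have := Finset.mem_Icc.1 hk
    exact_mod_cast (by omega : n + 2 - k < n + 1)
  have hdeg : (X ^ (n + 1) + Q).degree < ((n + 2 : ℕ) : WithBot ℕ) := by
    refine (degree_add_le _ _).trans_lt (max_lt ?_
      (hQdeg.trans (by exact_mod_cast Nat.lt_succ_self _)))
    exact (degree_X_pow_le _).trans_lt (by exact_mod_cast Nat.lt_succ_self _)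
  have hmonic : (X ^ (n + 2) + (X ^ (n + 1) + Q)).Monic := monic_X_pow_add hdeg
  have hQeval : ∀ z : R, Q.eval z ∈ IsLocalRing.maximalIdeal R := fun z => by
    rw [hQ, eval_finsetSum]
    refine Ideal.sum_mem _ fun k hk => ?_
    simpa using Ideal.mul_mem_right _ _ (he k hk)
  have hQ' : ∀ z : R, (derivative Q).eval z ∈ IsLocalRing.maximalIdeal R := fun z => by
    rw [hQ, derivative_sum, eval_finsetSum]
    refine Ideal.sum_mem _ fun k hk => ?_
    rw [derivative_C_mul, eval_mul, eval_C]
    exact Ideal.mul_mem_right _ _ (he k hk)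
  obtain ⟨z, hz, hz1⟩ := HenselianLocalRing.is_henselian _ hmonic (-1 : R)
    (by
      have : (X ^ (n + 2) + (X ^ (n + 1) + Q)).eval (-1 : R) = Q.eval (-1) := by
        simp [pow_succ]
      rw [this]; exact hQeval _)
    (by
      have : (derivative (X ^ (n + 2) + (X ^ (n + 1) + Q))).eval (-1 : R)
          = (-1) ^ (n + 1) + (derivative Q).eval (-1) := by
        simp [pow_succ, derivative_X_pow]; ring
      rw [this]
      by_contra h
      have h1 := (IsLocalRing.mem_maximalIdeal _).2 h
      have h2 := Ideal.sub_mem _ h1 (hQ' (-1))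
      rw [add_sub_cancel_right] at h2
      exact (IsLocalRing.mem_maximalIdeal _).1 h2 ((isUnit_one.neg).pow _))
  refine ⟨z, ?_, ?_⟩
  · have := hz
    rw [IsRoot, eval_add, eval_add, eval_pow, eval_pow, eval_X, hQ, eval_finsetSum] at this
    simp only [eval_mul, eval_C, eval_pow, eval_X] at this
    rw [← this]
    simp only [show n + 2 - 1 = n + 1 by omega]; ring
  · by_contra h
    have h1 := Ideal.sub_mem _ hz1 ((IsLocalRing.mem_maximalIdeal _).2 h)
    rw [sub_sub_cancel_left] at h1
    exact (IsLocalRing.mem_maximalIdeal _).1 h1 (by simp)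

/-- A polynomial whose constant coefficient is small compared with its linear coefficient has a root
of the size of Newton's approximation `-c 0 / c 1`. Hensel's lemma applies to a monic polynomial
only; the substitution of `c 0 / (c 1 * Z)` for the variable makes the polynomial monic in `Z`. -/
theorem Valuation.exists_root_of_small_coeff {K Γ₀ : Type*} [Field K]
    [LinearOrderedCommGroupWithZero Γ₀] (v : Valuation K Γ₀)
    [HenselianLocalRing v.valuationSubring] (n : ℕ) (hn : 2 ≤ n) (c : ℕ → K) (h1 : c 1 ≠ 0)
    (hc : ∀ k ∈ Finset.Icc 2 n, v (c k * c 0 ^ (k - 1) / c 1 ^ k) < 1) :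
    ∃ b : K, ∑ k ∈ Finset.range (n + 1), c k * b ^ k = 0 ∧ v b = v (c 0 / c 1) := by
  by_cases h0 : c 0 = 0
  · exact ⟨0, by simp [Finset.sum_range_succ', h0], by simp [h0]⟩
  classical
  let e : ℕ → v.valuationSubring := fun k =>
    if h : v (c k * c 0 ^ (k - 1) / c 1 ^ k) < 1 then ⟨_, h.le⟩ else 0
  have he : ∀ k ∈ Finset.Icc 2 n, (e k : K) = c k * c 0 ^ (k - 1) / c 1 ^ k := fun k hk => by
    simp only [e, dif_pos (hc k hk)]
  obtain ⟨z, hz, hzu⟩ := HenselianLocalRing.exists_root_near_neg_one n e (fun k hk => by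
    rw [Valuation.mem_maximalIdeal_iff, he k hk]; exact hc k hk) hn
  have hv : v (z : K) = 1 := by
    exact (Valuation.Integers.isUnit_iff_valuation_eq_one
      (Valuation.integer.integers v)).1 hzu
  have hz0 : (z : K) ≠ 0 := by
    intro h; simp [h] at hv
  refine ⟨c 0 / (c 1 * z), ?_, by simp [hv]⟩
  have hz' : (z : K) ^ n + (z : K) ^ (n - 1) + ∑ k ∈ Finset.Icc 2 n,
      (c k * c 0 ^ (k - 1) / c 1 ^ k) * (z : K) ^ (n - k) = 0 := by
    have := congrArg (Subtype.val) hz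
    push_cast at this
    rw [← this]
    congr 1
    exact Finset.sum_congr rfl fun k hk => by rw [he k hk]
  have key : ∑ k ∈ Finset.range (n + 1), c k * (c 0 / (c 1 * z)) ^ k =
      c 0 / (z : K) ^ n * ((z : K) ^ n + (z : K) ^ (n - 1) + ∑ k ∈ Finset.Icc 2 n,
      (c k * c 0 ^ (k - 1) / c 1 ^ k) * (z : K) ^ (n - k)) := by
    rw [Finset.range_eq_Ico, Finset.sum_eq_sum_Ico_succ_bot (by omega),
      Finset.sum_eq_sum_Ico_succ_bot (by omega), mul_add, mul_add, Finset.mul_sum, ← add_assoc]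
    congr 1
    · have : (z : K) ^ n = z * z ^ (n - 1) := by rw [← pow_succ']; congr 1; omega
      have h3 : c 1 * (c 0 / (c 1 * z)) = c 0 / z := by field_simp
      simp only [zero_add, pow_zero, pow_one, mul_one]
      rw [this, h3]; field_simp
    · refine Finset.sum_congr rfl fun k hk => ?_
      have hk := Finset.mem_Ico.1 hk
      have h1 : (z : K) ^ n = z ^ k * z ^ (n - k) := by rw [← pow_add]; congr 1; omega
      have h2 : c 0 ^ k = c 0 * c 0 ^ (k - 1) := by rw [← pow_succ']; congr 1; omega
      rw [h1, div_pow, mul_pow, h2]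
      have h3 : z ^ (n - k) ≠ 0 := pow_ne_zero _ (by rintro rfl; exact hz0 rfl)
      field_simp
  rw [key, hz', mul_zero]

/-- Simple roots depend continuously on the coefficients over a henselian valued field. -/
theorem Valued.exists_tendsto_root {K Γ₀ : Type*} [Field K]
    [LinearOrderedCommGroupWithZero Γ₀] [Valued K Γ₀]
    [HenselianLocalRing (Valued.v : Valuation K Γ₀).valuationSubring]
    {I : Type*} (l : Filter I) (n : ℕ) (P : I → K[X]) (P₀ : K[X])
    (hdeg : ∀ i, (P i).natDegree ≤ n)
    (hP : ∀ k, Tendsto (fun i => (P i).coeff k) l (𝓝 (P₀.coeff k)))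
    (a : K) (ha : P₀.eval a = 0) (ha' : (derivative P₀).eval a ≠ 0) (hdeg₀ : P₀.natDegree ≤ n) :
    ∃ w : I → K, Tendsto w l (𝓝 a) ∧ ∀ᶠ i in l, (P i).eval (w i) = 0 := by
  classical
  wlog hn : 2 ≤ n generalizing n
  · exact this (n + 2) (fun i => (hdeg i).trans (by omega)) (hdeg₀.trans (by omega)) (by omega)
  let c : I → ℕ → K := fun i k => (taylor a (P i)).coeff k
  let d : ℕ → K := fun k => (taylor a P₀).coeff k
  have htaylor : ∀ (Q : K[X]) k, Q.natDegree ≤ n → (taylor a Q).coeff k =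
      ∑ m ∈ Finset.range (n + 1), Q.coeff m * ((m.choose k : K) * a ^ (m - k)) := by
    intro Q k hQ
    rw [taylor_coeff, hasseDeriv_apply, sum_over_range' _ _ (n + 1) (by omega), eval_finsetSum]
    · refine Finset.sum_congr rfl fun m _ => ?_
      simp; ring
    · simp
  have hc : ∀ k, Tendsto (fun i => c i k) l (𝓝 (d k)) := by
    intro k
    simp only [c, d, htaylor _ k (hdeg _), htaylor _ k hdeg₀]
    exact tendsto_finsetSum _ fun m _ => (hP m).mul_const _
  have hd0 : d 0 = 0 := by simpa [d] using ha
  have hd1 : d 1 ≠ 0 := by simpa [d, taylor_coeff_one] using ha'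
  have hc0 := hc 0
  rw [hd0] at hc0
  have hgood : ∀ᶠ i in l, c i 1 ≠ 0 ∧ ∀ k ∈ Finset.Icc 2 n,
      Valued.v (c i k * c i 0 ^ (k - 1) / c i 1 ^ k) < (1 : Γ₀) := by
    refine ((hc 1).eventually_ne hd1).and ((Finset.eventually_all _).2 fun k hk => ?_)
    have h2 := Finset.mem_Icc.1 hk
    have ht : Tendsto (fun i => c i k * c i 0 ^ (k - 1) / c i 1 ^ k) l (𝓝 0) := by
      have := ((hc k).mul (hc0.pow (k - 1))).div ((hc 1).pow k) (pow_ne_zero _ hd1)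
      simpa [zero_pow (show k - 1 ≠ 0 by omega), Pi.div_def] using this
    have := ht.eventually ((Valued.hasBasis_nhds_zero K Γ₀).mem_of_mem (i := 1) trivial)
    filter_upwards [this] with i hi
    have hi : Valued.v.restrict _ < _ := hi
    rwa [Units.val_one, ← map_one (Valued.v.restrict : Valuation K _),
      Valuation.restrict_lt_iff, map_one] at hi
  have hex : ∀ i, ∃ b : K, (c i 1 ≠ 0 ∧ ∀ k ∈ Finset.Icc 2 n,
      Valued.v (c i k * c i 0 ^ (k - 1) / c i 1 ^ k) < (1 : Γ₀)) →
      ∑ k ∈ Finset.range (n + 1), c i k * b ^ k = 0 ∧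
        (Valued.v b : Γ₀) = Valued.v (c i 0 / c i 1) := by
    intro i
    by_cases h : (c i 1 ≠ 0 ∧ ∀ k ∈ Finset.Icc 2 n,
      Valued.v (c i k * c i 0 ^ (k - 1) / c i 1 ^ k) < (1 : Γ₀))
    · obtain ⟨b, hb⟩ := Valuation.exists_root_of_small_coeff (Valued.v : Valuation K Γ₀) n hn (c i)
        h.1 h.2
      exact ⟨b, fun _ => hb⟩
    · exact ⟨0, fun h' => (h h').elim⟩
  choose b hb using hex
  have hb0 : Tendsto b l (𝓝 0) := by
    rw [(Valued.hasBasis_nhds_zero K Γ₀).tendsto_right_iff]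
    intro γ _
    have ht : Tendsto (fun i => c i 0 / c i 1) l (𝓝 0) := by
      simpa [Pi.div_def] using hc0.div (hc 1) hd1
    filter_upwards [hgood, ht.eventually ((Valued.hasBasis_nhds_zero K Γ₀).mem_of_mem (i := γ)
      trivial)] with i hi hi'
    have : Valued.v.restrict (b i) = Valued.v.restrict (c i 0 / c i 1) :=
      (Valuation.restrict_inj _).2 (hb i hi).2
    change Valued.v.restrict (b i) < _
    rw [this]; exact hi'
  refine ⟨fun i => b i + a, by simpa using hb0.add_const a, ?_⟩
  filter_upwards [hgood] with i hi
  rw [← (hb i hi).1, ← taylor_eval, eval_eq_sum_range' (n := n + 1)]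
  rw [natDegree_taylor]; exact Nat.lt_succ_of_le (hdeg i)

/-! ### Hensel's lemma in several variables -/

/-- Residue-rational points of étale algebras over a henselian local ring lift to points. -/
theorem HenselianLocalRing.exists_algHom_lift_of_etale {R : Type*} [CommRing R]
    [HenselianLocalRing R] {T : Type*} [CommRing T] [Algebra R T] [Algebra.Etale R T]
    (ψ : T →ₐ[R] IsLocalRing.ResidueField R) :
    ∃ χ : T →ₐ[R] R, ∀ t, IsLocalRing.residue R (χ t) = ψ t := by
  let Q : Ideal T := RingHom.ker ψ
  have : Q.IsPrime := RingHom.ker_isPrime _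
  -- Near the kernel of `ψ` the algebra is standard étale, so that one polynomial has to be solved.
  obtain ⟨g, hgQ, hg⟩ := Algebra.IsEtaleAt.exists_isStandardEtale (R := R) Q
  obtain ⟨P⟩ := hg.nonempty_standardEtalePresentation
  have hgu : IsUnit (ψ g) := isUnit_iff_ne_zero.2 hgQ
  let ψ' : Localization.Away g →ₐ[R] IsLocalRing.ResidueField R :=
    IsLocalization.Away.liftAlgHom g (f := ψ) hgu
  have hψ' : ∀ t, ψ' (algebraMap T _ t) = ψ t := fun t => by
    simp [ψ', IsLocalization.Away.liftAlgHom]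
  obtain ⟨a₀, ha₀⟩ := IsLocalRing.residue_surjective (ψ' P.x)
  have heval : ∀ p : R[X], IsLocalRing.residue R (p.eval a₀) = ψ' (aeval P.x p) := by
    intro p
    rw [← aeval_algHom_apply, ← ha₀, ← coe_aeval_eq_eval]
    exact (aeval_algebraMap_apply (IsLocalRing.ResidueField R) a₀ p).symm
  have hunit : ∀ r : R, IsUnit r ↔ IsUnit (IsLocalRing.residue R r) := fun r => by
    simp [isUnit_iff_ne_zero]
  obtain ⟨r, hr, hra⟩ := HenselianLocalRing.is_henselian P.f P.monic_f a₀
    (by rw [← IsLocalRing.residue_eq_zero_iff, heval, P.hasMap.1, map_zero])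
    (by rw [hunit, heval]; exact P.hasMap.isUnit_derivative_f.map ψ')
  have hres : IsLocalRing.residue R r = ψ' P.x := by
    rw [← ha₀, ← sub_eq_zero, ← map_sub, IsLocalRing.residue_eq_zero_iff]; exact hra
  have hmap : P.HasMap r := by
    refine ⟨by simpa [coe_aeval_eq_eval] using hr, ?_⟩
    rw [hunit]
    have : IsLocalRing.residue R (aeval r P.g) = ψ' (aeval P.x P.g) := by
      rw [← aeval_algHom_apply ψ', ← hres]
      exact (aeval_algebraMap_apply (IsLocalRing.ResidueField R) r P.g).symm
    rw [this]; exact P.hasMap.2.map ψ'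
  let χ' : Localization.Away g →ₐ[R] R := (P.P.lift r hmap).comp P.equivRing.toAlgHom
  have hχ' : χ' P.x = r := by simp [χ']
  have hcomp : (Algebra.ofId R (IsLocalRing.ResidueField R)).comp χ' = ψ' := by
    apply P.hom_ext
    rw [AlgHom.comp_apply, hχ', ← hres]; rfl
  refine ⟨χ'.comp (IsScalarTower.toAlgHom R T _), fun t => ?_⟩
  rw [← hψ', ← hcomp]; rfl

/-- Hensel's lemma for square polynomial systems with invertible Jacobian determinant. -/
theorem HenselianLocalRing.exists_root_of_isUnit_det {R σ : Type*} [CommRing R]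
    [HenselianLocalRing R] [Fintype σ] [DecidableEq σ] (f : σ → MvPolynomial σ R) (a : σ → R)
    (ha : ∀ e, MvPolynomial.eval a (f e) ∈ IsLocalRing.maximalIdeal R)
    (hJ : IsUnit (Matrix.det (Matrix.of fun x e : σ =>
      MvPolynomial.eval a (MvPolynomial.pderiv x (f e))))) :
    ∃ b : σ → R, (∀ e, MvPolynomial.eval b (f e) = 0) ∧
      ∀ x, b x - a x ∈ IsLocalRing.maximalIdeal R := by
  -- The algebra defined by the system becomes étale when its Jacobian determinant is inverted.
  let P := Algebra.PreSubmersivePresentation.naive (R := R) (v := f) id Function.injective_id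
  let J := P.jacobian
  let T := Localization.Away J
  let P' := (Algebra.PreSubmersivePresentation.localizationAway T J).comp P
  have hu : IsUnit P'.jacobian := by
    have h := IsLocalization.Away.algebraMap_isUnit (S := T) J
    rw [Algebra.PreSubmersivePresentation.comp_jacobian_eq_jacobian_smul_jacobian,
      Algebra.PreSubmersivePresentation.localizationAway_jacobian, Algebra.smul_def]
    exact h.mul h
  let SP : Algebra.SubmersivePresentation R T (Unit ⊕ σ) (Unit ⊕ σ) := ⟨P', hu⟩
  have : Algebra.IsStandardSmoothOfRelativeDimension 0 R T :=
    SP.isStandardSmoothOfRelativeDimension (by simp [Algebra.Presentation.dimension])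
  have : Algebra.Etale R T := Algebra.Etale.iff_isStandardSmoothOfRelativeDimension_zero.2 this
  let φ₀ : MvPolynomial σ R →ₐ[R] IsLocalRing.ResidueField R :=
    MvPolynomial.aeval fun x => IsLocalRing.residue R (a x)
  have hφ₀ : ∀ p, φ₀ p = IsLocalRing.residue R (MvPolynomial.eval a p) := by
    intro p
    rw [← MvPolynomial.coe_aeval_eq_eval]
    exact MvPolynomial.aeval_algebraMap_apply (B := IsLocalRing.ResidueField R) a p
  let φ : (MvPolynomial σ R ⧸ Ideal.span (Set.range f)) →ₐ[R] IsLocalRing.ResidueField R :=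
    Ideal.Quotient.liftₐ _ φ₀ (by
      intro p hp
      have : Ideal.span (Set.range f) ≤ RingHom.ker φ₀ := by
        rw [Ideal.span_le]
        rintro _ ⟨e, rfl⟩
        rw [SetLike.mem_coe, RingHom.mem_ker, hφ₀]
        exact (IsLocalRing.residue_eq_zero_iff _).2 (ha e)
      exact this hp)
  have hφ : ∀ p, φ (Ideal.Quotient.mk _ p) = φ₀ p := fun p => rfl
  have hJφ : IsUnit (φ J) := by
    have : φ J = IsLocalRing.residue R (Matrix.det (Matrix.of fun x e : σ =>
      MvPolynomial.eval a (MvPolynomial.pderiv x (f e)))) := by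
      have h1 : J = Ideal.Quotient.mk _ P.jacobiMatrix.det :=
        P.jacobian_eq_jacobiMatrix_det
      rw [h1, hφ, hφ₀, RingHom.map_det]
      congr 2
      ext x e
      simp [P]
    rw [this]; exact hJ.map _
  let ψ : T →ₐ[R] IsLocalRing.ResidueField R := IsLocalization.Away.liftAlgHom J (f := φ) hJφ
  obtain ⟨χ, hχ⟩ := HenselianLocalRing.exists_algHom_lift_of_etale ψ
  let ξ : MvPolynomial σ R →ₐ[R] R :=
    (χ.comp (IsScalarTower.toAlgHom R _ T)).comp (Ideal.Quotient.mkₐ R (Ideal.span (Set.range f)))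
  have hξ : ∀ p, ξ p = MvPolynomial.eval (fun x => ξ (MvPolynomial.X x)) p := by
    intro p
    conv_lhs => rw [MvPolynomial.aeval_unique ξ]
    exact DFunLike.congr_fun (MvPolynomial.coe_aeval_eq_eval (⇑ξ ∘ MvPolynomial.X)) p
  refine ⟨fun x => ξ (MvPolynomial.X x), fun e => ?_, fun x => ?_⟩
  · rw [← hξ]
    have : Ideal.Quotient.mkₐ R (Ideal.span (Set.range f)) (f e) = 0 :=
      Ideal.Quotient.eq_zero_iff_mem.2 (Ideal.subset_span ⟨e, rfl⟩)
    simp only [ξ, AlgHom.comp_apply, this, map_zero]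
  · rw [← IsLocalRing.residue_eq_zero_iff, map_sub, sub_eq_zero]
    have h1 : IsLocalRing.residue R (ξ (MvPolynomial.X x)) =
      ψ (algebraMap _ T (Ideal.Quotient.mk (Ideal.span (Set.range f)) (MvPolynomial.X x))) := hχ _
    have h2 : ψ (algebraMap _ T (Ideal.Quotient.mk (Ideal.span (Set.range f))
        (MvPolynomial.X x))) = φ (Ideal.Quotient.mk _ (MvPolynomial.X x)) := by
      simp [ψ, IsLocalization.Away.liftAlgHom]
    rw [h1, h2, hφ, hφ₀, MvPolynomial.eval_X]

/-! ### Germs at nearby points -/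

theorem Filter.Germ.coeRingHom_surjective {S K : Type*} [Semiring K] (l : Filter S) :
    Function.Surjective (Germ.coeRingHom (R := K) l) :=
  fun g => Germ.inductionOn g fun f => ⟨f, rfl⟩

namespace NearbyGerm

/-- The ring of families of `K`-valued functions on `Y`, indexed by `S`, whose member with index
`s` is continuous at the point `y₀ s`. -/
def families (K : Type*) {S Y : Type*} [TopologicalSpace Y] [Field K] [TopologicalSpace K]
    [IsTopologicalRing K] (y₀ : S → Y) : Subring (S → Y → K) where
  carrier := {f | ∀ s, ContinuousAt (f s) (y₀ s)}
  mul_mem' hf hg s := (hf s).mul (hg s)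
  one_mem' _ := continuousAt_const
  add_mem' hf hg s := (hf s).add (hg s)
  zero_mem' _ := continuousAt_const
  neg_mem' hf s := (hf s).neg

/-- The families that, for `U`-almost all indices `s`, vanish on a neighbourhood of `y₀ s`. -/
def negligible (K : Type*) {S Y : Type*} [TopologicalSpace Y] [Field K] [TopologicalSpace K]
    [IsTopologicalRing K] (U : Ultrafilter S) (y₀ : S → Y) : Ideal (families K y₀) where
  carrier := {f | ∀ᶠ s in U, ∀ᶠ y in 𝓝 (y₀ s), f.1 s y = 0}
  add_mem' {f g} hf hg := by
    filter_upwards [hf, hg] with s hs ht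
    filter_upwards [hs, ht] with y hy hz
    change f.1 s y + g.1 s y = 0
    rw [hy, hz, add_zero]
  zero_mem' := Eventually.of_forall fun s => Eventually.of_forall fun y => rfl
  smul_mem' c f hf := by
    filter_upwards [hf] with s hs
    filter_upwards [hs] with y hy
    change c.1 s y * f.1 s y = 0
    rw [hy, mul_zero]

end NearbyGerm

/-- The ultraproduct along `U` of the rings of germs at `y₀ s` of functions `Y → K` that are
continuous at `y₀ s`. -/
abbrev NearbyGerm (K : Type*) {S Y : Type*} [TopologicalSpace Y] [Field K] [TopologicalSpace K]
    [IsTopologicalRing K] (U : Ultrafilter S) (y₀ : S → Y) : Type _ :=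
  NearbyGerm.families K y₀ ⧸ NearbyGerm.negligible K U y₀

namespace NearbyGerm

section
variable {K S Y : Type*} [TopologicalSpace Y] [Field K] [TopologicalSpace K]
    [IsTopologicalRing K] (U : Ultrafilter S) (y₀ : S → Y)

/-- Evaluation of a family at one index and one point. -/
def eval (s : S) (y : Y) : families K y₀ →+* K :=
  ((Pi.evalRingHom (fun _ : Y => K) y).comp (Pi.evalRingHom (fun _ : S => Y → K) s)).comp
    (families K y₀).subtype

@[simp] theorem eval_apply (s : S) (y : Y) (f : families K y₀) : eval y₀ s y f = f.1 s y := rfl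

/-- Evaluation at the base points. -/
noncomputable def residue : NearbyGerm K U y₀ →+* (U : Filter S).Germ K :=
  Ideal.Quotient.lift _
    ((Germ.coeRingHom (U : Filter S)).comp (RingHom.pi fun s => eval y₀ s (y₀ s)))
    (fun f hf => by
      change ((fun s => f.1 s (y₀ s) : S → K) : (U : Filter S).Germ K) = ((fun _ => 0 : S → K) :)
      refine Germ.coe_eq.2 ?_
      filter_upwards [show ∀ᶠ s in U, ∀ᶠ y in 𝓝 (y₀ s), f.1 s y = 0 from hf] with s hs
      exact hs.self_of_nhds)

theorem residue_mk (f : families K y₀) :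
    residue U y₀ (Ideal.Quotient.mk _ f) = ((fun s => f.1 s (y₀ s) : S → K) :) := rfl

theorem mk_eq_zero_iff (f : families K y₀) :
    Ideal.Quotient.mk (negligible K U y₀) f = 0 ↔
      ∀ᶠ s in U, ∀ᶠ y in 𝓝 (y₀ s), f.1 s y = 0 :=
  Ideal.Quotient.eq_zero_iff_mem

theorem mk_eq_mk_iff (f g : families K y₀) :
    Ideal.Quotient.mk (negligible K U y₀) f = Ideal.Quotient.mk _ g ↔
      ∀ᶠ s in U, ∀ᶠ y in 𝓝 (y₀ s), f.1 s y = g.1 s y := by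
  rw [← sub_eq_zero, ← map_sub, mk_eq_zero_iff]
  refine eventually_congr (Eventually.of_forall fun s =>
    eventually_congr (Eventually.of_forall fun y => ?_))
  exact sub_eq_zero

/-- Families that do not depend on the point of `Y`. -/
def constFamily : (S → K) →+* families K y₀ where
  toFun f := ⟨fun s _ => f s, fun _ => continuousAt_const⟩
  map_one' := rfl
  map_mul' _ _ := rfl
  map_zero' := rfl
  map_add' _ _ := rfl

/-- The section of the residue map that sends an element of the ultrapower to a family of
constant functions. -/
noncomputable def const : (U : Filter S).Germ K →+* NearbyGerm K U y₀ :=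
  RingHom.liftOfSurjective (Germ.coeRingHom (U : Filter S)) (Germ.coeRingHom_surjective _)
    ⟨(Ideal.Quotient.mk (negligible K U y₀)).comp (constFamily y₀), fun f hf => by
      rw [RingHom.mem_ker, RingHom.comp_apply, mk_eq_zero_iff]
      filter_upwards [Germ.coe_eq.1 (show (f : (U : Filter S).Germ K) = ((fun _ => 0 : S → K) :)
        from hf)] with s hs
      exact Eventually.of_forall fun _ => hs⟩

theorem const_coe (f : S → K) :
    const U y₀ (f : (U : Filter S).Germ K) = Ideal.Quotient.mk _ (constFamily y₀ f) :=
  DFunLike.congr_fun (f := (const U y₀).comp (Germ.coeRingHom (U : Filter S)))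
    (RingHom.liftOfRightInverse_comp _ _ _ _) f

theorem residue_const (g : (U : Filter S).Germ K) : residue U y₀ (const U y₀ g) = g := by
  induction g using Germ.inductionOn with
  | _ f => rw [const_coe, residue_mk]; rfl

end

section
variable {K S Y : Type*} [TopologicalSpace Y] [Field K] [TopologicalSpace K]
    [IsTopologicalDivisionRing K] [T1Space K] (U : Ultrafilter S) (y₀ : S → Y)

/-- Invertibility is detected at the base points, because inversion is continuous. -/
instance isLocalHom_residue : IsLocalHom (residue (K := K) U y₀) where
  map_nonunit a ha := by
    classical
    obtain ⟨f, rfl⟩ := Ideal.Quotient.mk_surjective a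
    have h1 : ∀ᶠ s in U, f.1 s (y₀ s) ≠ 0 := by
      by_contra h
      rw [← Ultrafilter.eventually_not] at h
      refine ha.ne_zero (Germ.coe_eq.2 ?_)
      filter_upwards [h] with s hs
      exact not_not.1 hs
    -- At the few indices where the value at the base point is zero the inverse may be discontinuous.
    let g : families K y₀ := ⟨fun s => if f.1 s (y₀ s) = 0 then 0 else (f.1 s)⁻¹, fun s => by
      dsimp only
      split_ifs with h
      · exact continuousAt_const
      · exact (f.2 s).inv₀ h⟩
    refine IsUnit.of_mul_eq_one (Ideal.Quotient.mk _ g) ?_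
    rw [← map_mul, ← map_one (Ideal.Quotient.mk _), mk_eq_mk_iff]
    filter_upwards [h1] with s hs
    filter_upwards [(f.2 s).eventually_ne hs] with y hy
    change f.1 s y * (if f.1 s (y₀ s) = 0 then 0 else (f.1 s)⁻¹) y = 1
    rw [if_neg hs]
    exact mul_inv_cancel₀ hy

instance : IsLocalRing (NearbyGerm K U y₀) := (residue U y₀).domain_isLocalRing

theorem mem_maximalIdeal_iff (a : NearbyGerm K U y₀) :
    a ∈ IsLocalRing.maximalIdeal _ ↔ residue U y₀ a = 0 := by
  rw [IsLocalRing.mem_maximalIdeal, mem_nonunits_iff, ← isUnit_map_iff (residue U y₀),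
    isUnit_iff_ne_zero, not_not]

end

/-- Hensel's lemma for nearby germs: the roots at the base points extend continuously to nearby
parameters, by the continuity of simple roots. -/
instance henselianLocalRing {K Γ₀ S Y : Type*} [TopologicalSpace Y] [Field K]
    [LinearOrderedCommGroupWithZero Γ₀] [Valued K Γ₀]
    [HenselianLocalRing (Valued.v : Valuation K Γ₀).valuationSubring]
    (U : Ultrafilter S) (y₀ : S → Y) : HenselianLocalRing (NearbyGerm K U y₀) where
  is_henselian f hf a ha ha' := by
    classical
    let q := Ideal.Quotient.mk (negligible K U y₀)
    obtain ⟨F, hF, -, hFm⟩ := lifts_and_natDegree_eq_and_monic (f := q)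
      ((lifts_iff_coeff_lifts _).2 fun n => Ideal.Quotient.mk_surjective _) hf
    obtain ⟨A, rfl⟩ := Ideal.Quotient.mk_surjective a
    have hev : ∀ (G : (families K y₀)[X]) (B : families K y₀) s y, (G.eval B).1 s y =
        (G.map (eval y₀ s y)).eval (B.1 s y) := fun G B s y => by
      rw [eval_map, ← eval_apply, ← eval_apply y₀ s y B, eval₂_hom]
    have hroot : ∀ᶠ s in U, (F.map (eval y₀ s (y₀ s))).eval (A.1 s (y₀ s)) = 0 := by
      rw [mem_maximalIdeal_iff, ← hF, eval_map, eval₂_hom, residue_mk] at ha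
      filter_upwards [Germ.coe_eq.1 (show _ = ((fun _ => 0 : S → K) : (U : Filter S).Germ K)
        from ha)] with s hs
      rw [← hev]; exact hs
    have hder : ∀ᶠ s in U, (derivative (F.map (eval y₀ s (y₀ s)))).eval (A.1 s (y₀ s)) ≠ 0 := by
      rw [← hF, derivative_map, eval_map, eval₂_hom] at ha'
      have h := (ha'.map (residue U y₀)).ne_zero
      rw [residue_mk] at h
      by_contra h'
      rw [← Ultrafilter.eventually_not] at h'
      refine h (Germ.coe_eq.2 ?_)
      filter_upwards [h'] with s hs
      rw [hev, ← derivative_map]; exact not_not.1 hs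
    have hex : ∀ s, ∃ w : Y → K, ContinuousAt w (y₀ s) ∧
        ((F.map (eval y₀ s (y₀ s))).eval (A.1 s (y₀ s)) = 0 ∧
          (derivative (F.map (eval y₀ s (y₀ s)))).eval (A.1 s (y₀ s)) ≠ 0 →
          w (y₀ s) = A.1 s (y₀ s) ∧ ∀ᶠ y in 𝓝 (y₀ s), (F.map (eval y₀ s y)).eval (w y) = 0) := by
      intro s
      by_cases h : (F.map (eval y₀ s (y₀ s))).eval (A.1 s (y₀ s)) = 0 ∧
          (derivative (F.map (eval y₀ s (y₀ s)))).eval (A.1 s (y₀ s)) ≠ 0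
      · obtain ⟨w, hw, hw'⟩ := Valued.exists_tendsto_root (𝓝 (y₀ s)) F.natDegree
          (fun y => F.map (eval y₀ s y)) (F.map (eval y₀ s (y₀ s)))
          (fun y => natDegree_map_le) (fun k => by
            simp only [coeff_map, eval_apply]; exact (F.coeff k).2 s) _ h.1 h.2 natDegree_map_le
        have hupd : ∀ y, y ≠ y₀ s → Function.update w (y₀ s) (A.1 s (y₀ s)) y = w y :=
          fun y hy => Function.update_of_ne hy _ _
        -- The root at the base point itself has to be the given one.
        refine ⟨Function.update w (y₀ s) (A.1 s (y₀ s)), ?_, fun _ => ⟨by simp, ?_⟩⟩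
        · rw [continuousAt_update_same]
          exact hw.mono_left nhdsWithin_le_nhds
        · filter_upwards [hw'] with y hy
          by_cases hyy : y = y₀ s
          · subst hyy; simpa using h.1
          · rw [hupd y hyy]; exact hy
      · exact ⟨fun _ => 0, continuousAt_const, fun h' => (h h').elim⟩
    choose w hwc hw using hex
    refine ⟨q ⟨w, hwc⟩, ?_, ?_⟩
    · rw [IsRoot, ← hF, eval_map, eval₂_hom, mk_eq_zero_iff]
      filter_upwards [hroot, hder] with s h1 h2
      filter_upwards [(hw s ⟨h1, h2⟩).2] with y hy
      rw [hev]; exact hy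
    · rw [mem_maximalIdeal_iff, ← map_sub, residue_mk]
      refine Germ.coe_eq.2 ?_
      filter_upwards [hroot, hder] with s h1 h2
      change w s (y₀ s) - A.1 s (y₀ s) = 0
      rw [(hw s ⟨h1, h2⟩).1, sub_self]

end NearbyGerm

/-! ### Lifting separably generated fields -/

/-- The lifting of `exists_ringHom_lift` on the purely transcendental extension `E⟮u⟯`: a nonzero
polynomial in `u` is mapped to a unit, because `ρ` is local. -/
theorem exists_ringHom_adjoin_simple_lift {R Ω E F : Type*} [CommRing R] [Field Ω] [Field E]
    [Field F] [Algebra E F] (ρ : R →+* Ω) [IsLocalHom ρ] (κ : E →+* R) (j : F →+* Ω)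
    (hκ : ∀ e, ρ (κ e) = j (algebraMap E F e)) (u : F) (hu : Transcendental E u) (τ : R)
    (hτ : ρ τ = j u) :
    ∃ θ : E⟮u⟯ →+* R, (∀ x, ρ (θ x) = j x) ∧ (∀ e, θ (algebraMap E E⟮u⟯ e) = κ e) ∧
      θ (IntermediateField.AdjoinSimple.gen E u) = τ := by
  let g : E[X] →+* R := eval₂RingHom κ τ
  have hg : ∀ p : E[X], ρ (g p) = j (aeval u p) := by
    intro p
    simp only [g, coe_eval₂RingHom, hom_eval₂, aeval_def, hτ]
    congr 1
    ext e; simp [hκ]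
  have hgu : ∀ p : (E[X])⁰, IsUnit (g p) := by
    intro p
    rw [← isUnit_map_iff ρ, hg, isUnit_iff_ne_zero, _root_.map_ne_zero]
    intro h
    exact nonZeroDivisors.coe_ne_zero p ((transcendental_iff.1 hu) _ h)
  let θ₀ : RatFunc E →+* R := IsLocalization.lift hgu
  have hθ₀ : ∀ p : E[X], θ₀ (algebraMap _ _ p) = g p := fun p => IsLocalization.lift_eq hgu p
  let ε := RatFunc.algEquivOfTranscendental u hu
  let θ : E⟮u⟯ →+* R := θ₀.comp (ε.symm : E⟮u⟯ →+* RatFunc E)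
  have hε : ∀ p : E[X], ε (algebraMap _ _ p) = aeval (IntermediateField.AdjoinSimple.gen E u) p :=
    RatFunc.algEquivOfTranscendental_algebraMap u hu
  have h1 : ∀ p : E[X], θ (aeval (IntermediateField.AdjoinSimple.gen E u) p) = g p := fun p => by
    simp [θ, ← hε, hθ₀]
  have hρ : ∀ x, ρ (θ x) = j x := by
    intro x
    obtain ⟨r, rfl⟩ := ε.surjective x
    have : (ρ.comp θ).comp (ε : RatFunc E →+* E⟮u⟯) =
        (j.comp (algebraMap E⟮u⟯ F)).comp (ε : RatFunc E →+* E⟮u⟯) := by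
      apply IsLocalization.ringHom_ext (E[X])⁰
      refine RingHom.ext fun p => ?_
      simp only [RingHom.comp_apply, RingHom.coe_coe, hε, h1, hg]
      congr 1
      exact aeval_algebraMap_apply F (IntermediateField.AdjoinSimple.gen E u) p
    exact DFunLike.congr_fun this r
  refine ⟨θ, hρ, fun e => ?_, ?_⟩
  · simpa [g] using h1 (C e)
  · simpa [g] using h1 X

/-- Let `ρ : R → Ω` be a surjective local homomorphism from a henselian local ring to a field, and
let `F` be finite separable over `E(u)`, with `u` transcendental over `E`. A homomorphism
`j : F → Ω` lifts to `R`, with prescribed values on `E` and at `u`. -/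
theorem exists_ringHom_lift {R Ω E F : Type*} [CommRing R] [HenselianLocalRing R] [Field Ω]
    [Field E] [Field F] [Algebra E F] (ρ : R →+* Ω) [IsLocalHom ρ] (hρ : Function.Surjective ρ)
    (κ : E →+* R) (j : F →+* Ω)
    (hκ : ∀ e, ρ (κ e) = j (algebraMap E F e)) (u : F) (hu : Transcendental E u)
    [FiniteDimensional E⟮u⟯ F] [Algebra.IsSeparable E⟮u⟯ F] (τ : R)
    (hτ : ρ τ = j u) :
    ∃ θ : F →+* R, (∀ x, ρ (θ x) = j x) ∧ (∀ e, θ (algebraMap E F e) = κ e) ∧ θ u = τ := by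
  obtain ⟨θ₀, h1, h2, h3⟩ := exists_ringHom_adjoin_simple_lift ρ κ j hκ u hu τ hτ
  have hunit : ∀ r : R, r ∈ IsLocalRing.maximalIdeal R ↔ ρ r = 0 := fun r => by
    rw [IsLocalRing.mem_maximalIdeal, mem_nonunits_iff, ← isUnit_map_iff ρ,
      isUnit_iff_ne_zero, not_not]
  let pb := Field.powerBasisOfFiniteOfSeparable E⟮u⟯ F
  let f := minpoly E⟮u⟯ pb.gen
  have hint : IsIntegral E⟮u⟯ pb.gen := Algebra.IsIntegral.isIntegral _
  obtain ⟨a₀, ha₀⟩ := hρ (j pb.gen)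
  have hev : ∀ p : E⟮u⟯[X], ρ ((p.map θ₀).eval a₀) = j (aeval pb.gen p) := by
    intro p
    rw [eval_map, hom_eval₂, aeval_def, hom_eval₂, ha₀]
    congr 1
    ext x; exact h1 x
  obtain ⟨a, ha, haa⟩ := HenselianLocalRing.is_henselian (f.map θ₀)
    ((minpoly.monic hint).map _) a₀
    (by rw [hunit, hev, minpoly.aeval, map_zero])
    (by
      rw [derivative_map, ← isUnit_map_iff ρ, hev, isUnit_iff_ne_zero, _root_.map_ne_zero]
      exact (Algebra.IsSeparable.isSeparable E⟮u⟯ pb.gen).aeval_derivative_ne_zero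
        (minpoly.aeval _ _))
  have hρa : ρ a = j pb.gen := by
    rw [← ha₀, ← sub_eq_zero, ← map_sub, ← hunit]; exact haa
  let := θ₀.toAlgebra
  let θ := pb.lift a (by rw [aeval_def, ← eval_map]; exact ha)
  have hθ : ∀ x : E⟮u⟯, θ (algebraMap _ F x) = θ₀ x := fun x => θ.commutes x
  have hθg : θ pb.gen = a := pb.lift_gen _ _
  refine ⟨θ, fun x => ?_, fun e => ?_, ?_⟩
  · obtain ⟨p, -, rfl⟩ := pb.exists_eq_aeval x
    change ρ (θ (aeval pb.gen p)) = _
    rw [← aeval_algHom_apply, hθg, aeval_def, aeval_def, hom_eval₂, hom_eval₂, hρa]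
    congr 1
    ext x; exact h1 x
  · rw [← h2]; exact hθ (algebraMap E E⟮u⟯ e)
  · rw [← h3]; exact hθ (IntermediateField.AdjoinSimple.gen E u)

/-! ### Fields generated by powers -/

section FrobeniusSpan
variable (k : Type*) {F : Type*} [Field k] [Field F] [Algebra k F]

theorem mem_adjoin_range_pow_iff (q : ℕ) (x : F) :
    x ∈ Algebra.adjoin k (Set.range fun u : F => u ^ q) ↔
      x ∈ Submodule.span k (Set.range fun u : F => u ^ q) := by
  have h : (Submonoid.closure (Set.range fun u : F => u ^ q) : Set F) =
      Set.range fun u : F => u ^ q :=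
    congrArg _ (Submonoid.closure_eq (MonoidHom.mrange (powMonoidHom q : F →* F)))
  rw [← Subalgebra.mem_toSubmodule, Algebra.adjoin_eq_span, h]

variable (F) in
/-- The subfield of `F` generated by `k` and all `q`-th powers. It is spanned by the `q`-th powers
over `k`, see `mem_powerField_iff`. -/
def powerField (q : ℕ) (hq : q ≠ 0) : IntermediateField k F :=
  (Algebra.adjoin k (Set.range fun u : F => u ^ q)).toIntermediateField fun x hx => by
    have h1 : x⁻¹ = x ^ (q - 1) * (x⁻¹) ^ q := by
      obtain ⟨r, rfl⟩ := Nat.exists_eq_succ_of_ne_zero hq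
      by_cases h : x = 0
      · simp [h]
      · simp [pow_succ, h]
    rw [h1]
    exact mul_mem (pow_mem hx _) (Algebra.subset_adjoin ⟨_, rfl⟩)

variable {k}

theorem mem_powerField_iff {q : ℕ} (hq : q ≠ 0) {x : F} :
    x ∈ powerField k F q hq ↔ x ∈ Submodule.span k (Set.range fun u : F => u ^ q) :=
  mem_adjoin_range_pow_iff k q x

theorem pow_mem_powerField {q : ℕ} (hq : q ≠ 0) (x : F) : x ^ q ∈ powerField k F q hq :=
  Algebra.subset_adjoin ⟨x, rfl⟩

theorem powerField_le {q : ℕ} (hq : q ≠ 0) {M : Subalgebra k F} (h : ∀ x : F, x ^ q ∈ M) :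
    (powerField k F q hq).toSubalgebra ≤ M :=
  Algebra.adjoin_le (by rintro _ ⟨x, rfl⟩; exact h x)

end FrobeniusSpan

/-- The exponents of the variable in an identity `w * b(w ^ m) = a(w ^ m)` have different residues
modulo `m` on the two sides. -/
theorem Transcendental.notMem_adjoin_pow {k F : Type*} [Field k] [Field F] [Algebra k F] {w : F}
    (hw : Transcendental k w) {m : ℕ} (hm : 2 ≤ m) : w ∉ k⟮w ^ m⟯ := by
  intro h
  obtain ⟨a, b, hab⟩ := (IntermediateField.mem_adjoin_simple_iff k w).1 h
  have hw0 : w ≠ 0 := fun h0 => hw (h0 ▸ isAlgebraic_zero)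
  have hb : Polynomial.aeval (w ^ m) b ≠ 0 := by
    intro hb; rw [hb, div_zero] at hab; exact hw0 hab
  have h1 : X * expand k m b = expand k m a := by
    apply transcendental_iff_injective.1 hw
    rw [map_mul, aeval_X, expand_aeval, expand_aeval]
    nth_rewrite 1 [hab]
    exact div_mul_cancel₀ _ hb
  have hb0 : b ≠ 0 := by rintro rfl; simp at hb
  obtain ⟨i, hi⟩ : ∃ i, b.coeff i ≠ 0 := by
    by_contra! h; exact hb0 (Polynomial.ext h)
  have h2 := congrArg (fun f => f.coeff (i * m + 1)) h1
  simp only [coeff_X_mul] at h2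
  rw [coeff_expand_mul (by omega), coeff_expand (by omega), if_neg] at h2
  · exact hi h2
  · intro hd
    have := (Nat.dvd_add_right (Dvd.intro_left i rfl)).1 hd
    have := Nat.le_of_dvd one_pos this
    omega

/-- If `u` is separable over `E`, then `u ^ q` is separable over any field that contains the
`q`-th powers of the elements of `E`. -/
theorem IsSeparable.pow_expChar_pow {E M F : Type*} [Field E] [Field M] [Field F] [Algebra E F]
    [Algebra M F] (p n : ℕ) [ExpChar F p] (φ : E →+* M)
    (hφ : ∀ e, algebraMap M F (φ e) = algebraMap E F e ^ p ^ n) {u : F} (hu : IsSeparable E u) :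
    IsSeparable M (u ^ p ^ n) := by
  have h1 : aeval (u ^ p ^ n) ((minpoly E u).map φ) = 0 := by
    have h2 : aeval (u ^ p ^ n) ((minpoly E u).map φ) =
        iterateFrobenius F p n (aeval u (minpoly E u)) := by
      rw [aeval_def, eval₂_map, aeval_def, hom_eval₂, iterateFrobenius_def]
      congr 1
      ext e
      simp [hφ, iterateFrobenius_def]
    rw [h2, minpoly.aeval, map_zero]
  exact (Separable.map hu (f := φ)).of_dvd (minpoly.dvd _ _ h1)

/-- If `F` is separable over `K'(t)`, then an element of `k F^q`, `q = p ^ n`, is separable over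
`K'(t ^ q)`, while the degree of `t` over the separable closure of `K'(t ^ q)` is `q`.  So `q` is
bounded by the degree of `t` over `K'(x)`. -/
theorem exists_notMem_powerField_of_separating {k F : Type*} [Field k] [Field F] [Algebra k F]
    (p : ℕ) (hp : p.Prime) [ExpChar F p] {x t : F} (K' : IntermediateField k F)
    (ht : Transcendental K' t) (hx : IsAlgebraic K'⟮x⟯ t) [Algebra.IsSeparable K'⟮t⟯ F] :
    ∃ n, x ∉ powerField k F (p ^ n) (pow_ne_zero n hp.ne_zero) := by
  set g := minpoly K'⟮x⟯ t with hg
  obtain ⟨n, hn⟩ : ∃ n, g.natDegree < p ^ n := ⟨_, Nat.lt_pow_self hp.one_lt⟩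
  refine ⟨n, fun hxn => ?_⟩
  let M := K'⟮t ^ p ^ n⟯
  let N := separableClosure M F
  have hMp : ∀ e : K'⟮t⟯, (e : F) ^ p ^ n ∈ M := by
    have h1 : K'⟮t⟯.toSubfield ≤ M.toSubfield.comap (iterateFrobenius F p n) := by
      rw [IntermediateField.adjoin_toSubfield, Subfield.closure_le]
      rintro _ (⟨e, rfl⟩ | rfl)
      · exact pow_mem (M.algebraMap_mem e) _
      · exact IntermediateField.mem_adjoin_simple_self K' _
    exact fun e => h1 e.2
  let φ : K'⟮t⟯ →+* M := ((iterateFrobenius F p n).comp K'⟮t⟯.val.toRingHom).codRestrict M hMp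
  have hpow : ∀ u : F, u ^ p ^ n ∈ N := fun u =>
    (Algebra.IsSeparable.isSeparable K'⟮t⟯ u).pow_expChar_pow p n φ (fun e => rfl)
  have hxN : x ∈ N := by
    have := powerField_le (k := k) (pow_ne_zero n hp.ne_zero)
      (M := ((N.restrictScalars K').restrictScalars k).toSubalgebra) hpow
    exact this hxn
  have hxM : K'⟮x⟯ ≤ N.restrictScalars K' := by
    rw [IntermediateField.adjoin_simple_le_iff]; exact hxN
  let ψ : K'⟮x⟯ →+* N := K'⟮x⟯.val.toRingHom.codRestrict N (fun e => hxM e.2)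
  have hgt : aeval t (g.map ψ) = 0 := by
    have : aeval t (g.map ψ) = aeval t g := by
      rw [aeval_def, eval₂_map, aeval_def]; rfl
    rw [this, hg, minpoly.aeval]
  have hg0 : g.map ψ ≠ 0 := by
    rw [Polynomial.map_ne_zero_iff ψ.injective]
    exact minpoly.ne_zero hx.isIntegral
  have hdeg : (minpoly N t).natDegree ≤ g.natDegree := by
    rw [← natDegree_map_eq_of_injective ψ.injective g]
    exact natDegree_le_of_dvd (minpoly.dvd _ _ hgt) hg0
  have : ExpChar N p := (algebraMap N F).expChar (algebraMap N F).injective p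
  have : ExpChar M p := (algebraMap M F).expChar (algebraMap M F).injective p
  have hins : IsPurelyInseparable N N⟮t⟯ :=
    (IntermediateField.isPurelyInseparable_adjoin_simple_iff_pow_mem N F p).2
      ⟨n, ⟨⟨_, hpow t⟩, rfl⟩⟩
  obtain ⟨e, y, hy⟩ := IsPurelyInseparable.minpoly_eq_X_pow_sub_C N p
    (IntermediateField.AdjoinSimple.gen N t)
  rw [IntermediateField.minpoly_gen] at hy
  have hte : t ^ p ^ e = y := by
    have := minpoly.aeval N t
    rw [hy] at this
    simpa [sub_eq_zero] using this
  rw [hy, natDegree_X_pow_sub_C] at hdeg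
  have hen : e < n := (Nat.pow_lt_pow_iff_right hp.one_lt).1 (hdeg.trans_lt hn)
  -- `t ^ p ^ e` is both separable and purely inseparable over `M`.
  have hsep : IsSeparable M (t ^ p ^ e) := hte ▸ y.2
  have hmem : t ^ p ^ e ∈ M := by
    have h1 : IsPurelyInseparable M M⟮t ^ p ^ e⟯ :=
      (IntermediateField.isPurelyInseparable_adjoin_simple_iff_pow_mem M F p).2
        ⟨n - e, ⟨⟨t ^ p ^ n, IntermediateField.mem_adjoin_simple_self K' _⟩, by
          rw [← pow_mul, ← pow_add, show e + (n - e) = n by omega]; rfl⟩⟩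
    have h2 : Algebra.IsSeparable M M⟮t ^ p ^ e⟯ :=
      (IntermediateField.isSeparable_adjoin_simple_iff_isSeparable M F).2 hsep
    have h3 := IntermediateField.eq_bot_of_isPurelyInseparable_of_isSeparable M⟮t ^ p ^ e⟯
    obtain ⟨m, hm⟩ := IntermediateField.mem_bot.1 (IntermediateField.adjoin_simple_eq_bot_iff.1 h3)
    rw [← hm]; exact m.2
  -- `t ^ p ^ e` would be a rational function of its own power `t ^ p ^ n`.
  have htr : Transcendental K' (t ^ p ^ e) := ht.pow (pow_pos hp.pos _)
  refine htr.notMem_adjoin_pow (m := p ^ (n - e)) ?_ ?_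
  · exact hp.two_le.trans (Nat.le_self_pow (by omega) p)
  · rw [← pow_mul, ← pow_add, show e + (n - e) = n by omega]
    exact hmem

/-! ### Separating transcendence bases -/

theorem IsAlgebraic.of_ringHom_comm {E M F : Type*} [Field E] [Field M] [Field F] [Algebra E F]
    [Algebra M F] (φ : E →+* M) (hφ : ∀ e, algebraMap M F (φ e) = algebraMap E F e) {y : F}
    (hy : IsAlgebraic E y) : IsAlgebraic M y := by
  obtain ⟨P, hP, hPy⟩ := hy
  have h : (algebraMap M F).comp φ = algebraMap E F := RingHom.ext hφ
  refine ⟨P.map φ, (Polynomial.map_ne_zero_iff φ.injective).2 hP, ?_⟩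
  rw [Polynomial.aeval_def, eval₂_map, h]
  exact hPy

theorem IsSeparable.of_ringHom_comm {E M F : Type*} [Field E] [Field M] [Field F] [Algebra E F]
    [Algebra M F] (φ : E →+* M) (hφ : ∀ e, algebraMap M F (φ e) = algebraMap E F e) {y : F}
    (hy : IsSeparable E y) : IsSeparable M y := by
  have h : (algebraMap M F).comp φ = algebraMap E F := RingHom.ext hφ
  refine (Separable.map hy (f := φ)).of_dvd (minpoly.dvd _ _ ?_)
  rw [Polynomial.aeval_def, eval₂_map, h]
  exact minpoly.aeval _ y

/-- The extension `M⟮t⟯` has prime degree `p` over `M`, so each of its elements outside `M`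
generates it. -/
theorem IntermediateField.adjoin_simple_eq_of_pow_mem {M F : Type*} [Field M] [Field F]
    [Algebra M F] {p : ℕ} (hp : p.Prime) [CharP F p] {t u : F}
    (ht : ∃ a : M, algebraMap M F a = t ^ p) (hu : ∃ a : M, algebraMap M F a = u ^ p)
    (huM : u ∉ (⊥ : IntermediateField M F)) (hut : u ∈ M⟮t⟯) : M⟮u⟯ = M⟮t⟯ := by
  have : Fact p.Prime := ⟨hp⟩
  have key : ∀ w : F, (∃ a : M, algebraMap M F a = w ^ p) → w ∉ (⊥ : IntermediateField M F) →
      IsIntegral M w ∧ Module.finrank M M⟮w⟯ = p := by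
    rintro w ⟨a, ha⟩ hw
    have hirr : Irreducible (X ^ p - C a) := X_pow_sub_C_irreducible_of_prime hp fun b hb => by
      apply hw
      have : (algebraMap M F b) ^ p = w ^ p := by rw [← ha, ← map_pow, hb]
      exact IntermediateField.mem_bot.2 ⟨b, frobenius_inj F p this⟩
    have hmin : X ^ p - C a = minpoly M w :=
      minpoly.eq_of_irreducible_of_monic hirr (by simp [ha]) (monic_X_pow_sub_C a hp.ne_zero)
    have hint : IsIntegral M w := ⟨_, monic_X_pow_sub_C a hp.ne_zero, by
      rw [← aeval_def]; simp [ha]⟩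
    refine ⟨hint, ?_⟩
    rw [IntermediateField.adjoin.finrank hint, ← hmin, natDegree_X_pow_sub_C]
  have htM : t ∉ (⊥ : IntermediateField M F) := fun h => by
    rw [IntermediateField.adjoin_simple_eq_bot_iff.2 h] at hut
    exact huM hut
  have : FiniteDimensional M M⟮t⟯ := IntermediateField.adjoin.finiteDimensional (key t ht htM).1
  refine IntermediateField.eq_of_le_of_finrank_eq
    (IntermediateField.adjoin_simple_le_iff.2 hut) ?_
  rw [(key t ht htM).2, (key u hu huM).2]

/-- If all differentials over the field `M` vanish on `F`, then `F` is separable over `M`. -/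
theorem Algebra.isSeparable_of_forall_D_eq_zero {M F : Type*} [Field M] [Field F] [Algebra M F]
    [Algebra.EssFiniteType M F] (h : ∀ y : F, KaehlerDifferential.D M F y = 0) :
    Algebra.IsSeparable M F := by
  have : Algebra.FormallyUnramified M F := ⟨by
    rw [← Submodule.subsingleton_iff F, ← subsingleton_iff_bot_eq_top,
      ← KaehlerDifferential.span_range_derivation M F, eq_comm, Submodule.span_eq_bot]
    rintro _ ⟨y, rfl⟩
    exact h y⟩
  exact Algebra.FormallyUnramified.isSeparable M F

/-- An element `u` of `F` outside the subfield generated by `k` and the `p`-th powers is a member of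
a separating transcendence basis of `F` over `k`; the rest of the basis generates `L`. The element
`u` can be exchanged for some `t ∈ s` in the generation of `F` over `k F^p`, and separability over
`L(u)` means that a derivation vanishing there is zero. -/
theorem exists_separating_of_notMem_powerField {k F : Type*} [Field k] [Field F] [Algebra k F]
    [Algebra.EssFiniteType k F] {p : ℕ} (hp : p.Prime) [CharP F p] (s : Finset F)
    (hs : IsTranscendenceBasis k ((↑) : s → F))
    [Algebra.IsSeparable (IntermediateField.adjoin k (s : Set F)) F] {u : F}
    (hu : u ∉ powerField k F p hp.ne_zero) :
    ∃ L : IntermediateField k F, Transcendental L u ∧ Algebra.IsSeparable L⟮u⟯ F := by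
  classical
  have : Fact p.Prime := ⟨hp⟩
  have : ExpChar F p := .prime hp
  let P := powerField k F p hp.ne_zero
  let M : Finset F → IntermediateField k F := fun A => P ⊔ IntermediateField.adjoin k (A : Set F)
  have hPM : ∀ A, P ≤ M A := fun A => le_sup_left
  have htop : M s = ⊤ := by
    have : ExpChar (M s) p := (algebraMap (M s) F).expChar (algebraMap (M s) F).injective p
    have h1 : IsPurelyInseparable (M s) F := (isPurelyInseparable_iff_pow_mem (M s) p).2
      fun y => ⟨1, ⟨⟨y ^ p ^ 1, by rw [pow_one]; exact hPM s (pow_mem_powerField _ y)⟩, rfl⟩⟩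
    have h2 : Algebra.IsSeparable (M s) F := ⟨fun y => by
      have hle : IntermediateField.adjoin k (s : Set F) ≤ M s := le_sup_right
      have hy := Algebra.IsSeparable.isSeparable (IntermediateField.adjoin k (s : Set F)) y
      exact hy.of_ringHom_comm (IntermediateField.inclusion hle).toRingHom fun _ => rfl⟩
    rw [eq_top_iff]
    intro y _
    obtain ⟨m, rfl⟩ := IsPurelyInseparable.surjective_algebraMap_of_isSeparable (M s) F y
    exact m.2
  -- In a minimal `A ⊆ s` with `u ∈ k F^p(A)` every element can be exchanged for `u`.
  obtain ⟨A, hAs, hAu, hAmin⟩ : ∃ A ⊆ s, u ∈ M A ∧ ∀ B ⊂ A, u ∉ M B := by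
    have hex : ∃ n, ∃ A ⊆ s, u ∈ M A ∧ A.card = n :=
      ⟨_, s, subset_rfl, by rw [htop]; trivial, rfl⟩
    obtain ⟨A, hAs, hAu, hAc⟩ := Nat.find_spec hex
    refine ⟨A, hAs, hAu, fun B hB huB => ?_⟩
    exact Nat.find_min hex (hAc ▸ Finset.card_lt_card hB) ⟨B, hB.subset.trans hAs, huB, rfl⟩
  obtain ⟨t, htA⟩ : A.Nonempty := by
    rw [Finset.nonempty_iff_ne_empty]
    rintro rfl
    apply hu
    simpa [M] using hAu
  have hts := hAs htA
  let M' := M (A.erase t)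
  have huM' : u ∉ M' := hAmin _ (Finset.erase_ssubset htA)
  have hMt : M A = M'⟮t⟯.restrictScalars k := by
    rw [IntermediateField.restrictScalars_adjoin_eq_sup]
    simp only [M', M]
    rw [sup_assoc, ← IntermediateField.adjoin_union]
    congr 2
    ext y; by_cases h : y = t <;> simp [h, htA]
  have heq : M'⟮u⟯ = M'⟮t⟯ := by
    refine IntermediateField.adjoin_simple_eq_of_pow_mem hp
      ⟨⟨t ^ p, hPM _ (pow_mem_powerField _ t)⟩, rfl⟩
      ⟨⟨u ^ p, hPM _ (pow_mem_powerField _ u)⟩, rfl⟩ ?_ ?_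
    · rintro h
      obtain ⟨m, hm⟩ := IntermediateField.mem_bot.1 h
      exact huM' (hm ▸ m.2)
    · have := hAu
      rw [hMt] at this
      exact this
  have htu : t ∈ M'⟮u⟯ := heq ▸ IntermediateField.mem_adjoin_simple_self M' t
  let L := IntermediateField.adjoin k ((s.erase t : Finset F) : Set F)
  have : Algebra.EssFiniteType L F := Algebra.EssFiniteType.of_comp k _ F
  have hess : Algebra.EssFiniteType L⟮u⟯ F := Algebra.EssFiniteType.of_comp L _ F
  have hsep : Algebra.IsSeparable L⟮u⟯ F := by
    refine Algebra.isSeparable_of_forall_D_eq_zero fun y => ?_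
    let D := KaehlerDifferential.D L⟮u⟯ F
    -- The constants of the universal derivation contain `L`, `u` and all `p`-th powers.
    let Z : IntermediateField k F :=
      { carrier := {y | D y = 0}
        mul_mem' := fun {a b} ha hb => by
          simp only [Set.mem_ofPred_eq] at ha hb ⊢
          rw [Derivation.leibniz, ha, hb, smul_zero, smul_zero, add_zero]
        add_mem' := fun {a b} ha hb => by
          simp only [Set.mem_ofPred_eq] at ha hb ⊢
          rw [map_add, ha, hb, add_zero]
        algebraMap_mem' := fun c => D.map_algebraMap (algebraMap k L⟮u⟯ c)
        inv_mem' := fun a ha => by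
          simp only [Set.mem_ofPred_eq] at ha ⊢
          rw [Derivation.leibniz_inv, ha, smul_zero] }
    have hL : L ≤ Z := fun e he =>
      D.map_algebraMap (algebraMap L L⟮u⟯ ⟨e, he⟩)
    have huZ : u ∈ Z := D.map_algebraMap (IntermediateField.AdjoinSimple.gen L u)
    have hPZ : P ≤ Z := powerField_le (M := Z.toSubalgebra) hp.ne_zero fun y => by
      change D (y ^ p) = 0
      rw [Derivation.leibniz_pow, ← Nat.cast_smul_eq_nsmul F, CharP.cast_eq_zero, zero_smul]
    have hM'Z : M' ≤ Z := by
      refine sup_le hPZ (le_trans (IntermediateField.adjoin.mono _ _ _ ?_) hL)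
      exact_mod_cast Finset.erase_subset_erase t hAs
    have htZ : t ∈ Z := by
      let Z' : IntermediateField M' F := IntermediateField.extendScalars hM'Z
      have : M'⟮u⟯ ≤ Z' := IntermediateField.adjoin_simple_le_iff.2 huZ
      exact this htu
    have : M s ≤ Z := by
      refine sup_le hPZ (IntermediateField.adjoin_le_iff.2 fun e he => ?_)
      by_cases h : e = t
      · exact h ▸ htZ
      · exact hL (IntermediateField.subset_adjoin _ _ (by simpa [h] using he))
    rw [htop] at this
    exact this (IntermediateField.mem_top (x := y))
  refine ⟨L, fun halg => ?_, hsep⟩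
  have h1 : Algebra.IsAlgebraic L L⟮u⟯ :=
    IntermediateField.isAlgebraic_adjoin_simple halg.isIntegral
  have h2 : Algebra.IsAlgebraic L F := Algebra.IsAlgebraic.trans L L⟮u⟯ F
  have h3 : Transcendental (Algebra.adjoin k ((s.erase t : Finset F) : Set F)) t := by
    have := hs.1.transcendental_adjoin (s := {⟨t, hts⟩}ᶜ) (i := ⟨t, hts⟩) (by simp)
    have e : ((↑) : s → F) '' {⟨t, hts⟩}ᶜ = ((s.erase t : Finset F) : Set F) := by
      ext y; simp; tauto
    rwa [e] at this
  exact h3 (IntermediateField.isAlgebraic_adjoin_iff.1 (h2.isAlgebraic t))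

/-- Over a separably generated field a transcendental element is not infinitely `p`-divisible, in
the sense of lying in all the fields `k F^(p ^ n)`. -/
theorem exists_notMem_powerField {k F : Type*} [Field k] [Field F] [Algebra k F]
    {p : ℕ} (hp : p.Prime) [ExpChar F p] (s : Finset F)
    (hs : IsTranscendenceBasis k ((↑) : s → F))
    [Algebra.IsSeparable (IntermediateField.adjoin k (s : Set F)) F] {x : F}
    (hx : Transcendental k x) :
    ∃ n, x ∉ powerField k F (p ^ n) (pow_ne_zero n hp.ne_zero) := by
  classical
  have hxi : AlgebraicIndepOn k id ({x} : Set F) := by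
    have : AlgebraicIndependent k (fun i : ({x} : Set F) => (i : F)) :=
      (algebraicIndependent_unique_type_iff (x := fun i : ({x} : Set F) => (i : F))).2 hx
    exact this
  have hrange : Set.range ((↑) : s → F) = (s : Set F) := Subtype.range_coe
  have h0 : Algebra.IsAlgebraic (Algebra.adjoin k (s : Set F)) F := hrange ▸ hs.isAlgebraic
  have hsi : Algebra.IsAlgebraic (Algebra.adjoin k (insert x (s : Set F))) F := by
    refine ⟨fun y => ?_⟩
    exact (h0.isAlgebraic y).adjoin_of_forall_isAlgebraic (fun z hz => absurd (Or.inr hz.1) hz.2)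
  obtain ⟨s', hxs', hs's, hs'⟩ := exists_isTranscendenceBasis_between {x} (insert x (s : Set F))
    (by simp) hxi
  -- The basis `s'` contains `x` and misses some `t ∈ s` (unless `x` itself is in `s`).
  obtain ⟨t, hts, hst⟩ : ∃ t ∈ s, s' ⊆ insert x ((s.erase t : Finset F) : Set F) := by
    by_cases hxs : x ∈ s
    · refine ⟨x, hxs, hs's.trans ?_⟩
      rw [Finset.coe_erase, Set.insert_sdiff_singleton]
    obtain ⟨t, hts, hts'⟩ : ∃ t ∈ s, t ∉ s' := by
      by_contra! hcon
      have hx' : x ∈ s' := hxs' rfl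
      have h1 := hs'.1.transcendental_adjoin (s := {⟨x, hx'⟩}ᶜ) (i := ⟨x, hx'⟩) (by simp)
      refine h1 ((h0.isAlgebraic x).adjoin_of_forall_isAlgebraic fun z hz => absurd ?_ hz.2)
      exact ⟨⟨z, hcon z hz.1⟩, fun h => hxs (by
        have : z = x := congrArg Subtype.val h
        exact this ▸ hz.1), rfl⟩
    refine ⟨t, hts, fun y hy => ?_⟩
    rcases hs's hy with rfl | h
    · exact Or.inl rfl
    · refine Or.inr ?_
      rw [Finset.mem_coe, Finset.mem_erase]
      exact ⟨fun h' => hts' (h' ▸ hy), h⟩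
  let K' := IntermediateField.adjoin k ((s.erase t : Finset F) : Set F)
  have ht : Transcendental K' t := fun halg => by
    have := hs.1.transcendental_adjoin (s := {⟨t, hts⟩}ᶜ) (i := ⟨t, hts⟩) (by simp)
    have e : ((↑) : s → F) '' {⟨t, hts⟩}ᶜ = ((s.erase t : Finset F) : Set F) := by
      ext y; simp; tauto
    rw [e] at this
    exact this (IntermediateField.isAlgebraic_adjoin_iff.1 halg)
  have hxt : IsAlgebraic K'⟮x⟯ t := by
    have hrange' : Set.range ((↑) : s' → F) = s' := Subtype.range_coe
    have h1 : Algebra.IsAlgebraic (Algebra.adjoin k s') F := hrange' ▸ hs'.isAlgebraic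
    have h2 : IsAlgebraic (IntermediateField.adjoin k s') t :=
      IntermediateField.isAlgebraic_adjoin_iff.2 (h1.isAlgebraic t)
    have hle : IntermediateField.adjoin k s' ≤ K'⟮x⟯.restrictScalars k := by
      refine IntermediateField.adjoin_le_iff.2 fun y hy => ?_
      rcases hst hy with rfl | h
      · exact IntermediateField.mem_adjoin_simple_self K' y
      · exact K'⟮x⟯.algebraMap_mem ⟨y, IntermediateField.subset_adjoin _ _ h⟩
    exact h2.of_ringHom_comm (IntermediateField.inclusion hle).toRingHom fun _ => rfl
  have hsep : Algebra.IsSeparable K'⟮t⟯ F := ⟨fun y => by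
    have hle : IntermediateField.adjoin k (s : Set F) ≤ K'⟮t⟯.restrictScalars k := by
      refine IntermediateField.adjoin_le_iff.2 fun y hy => ?_
      by_cases h : y = t
      · exact h ▸ IntermediateField.mem_adjoin_simple_self K' t
      · exact K'⟮t⟯.algebraMap_mem ⟨y, IntermediateField.subset_adjoin _ _ (by simpa [h] using hy)⟩
    have hy := Algebra.IsSeparable.isSeparable (IntermediateField.adjoin k (s : Set F)) y
    exact hy.of_ringHom_comm (IntermediateField.inclusion hle).toRingHom fun _ => rfl⟩
  exact exists_notMem_powerField_of_separating p hp K' ht hxt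

theorem finiteDimensional_of_essFiniteType_of_isSeparable (k M F : Type*) [Field k] [Field M]
    [Field F] [Algebra k M] [Algebra k F] [Algebra M F] [IsScalarTower k M F]
    [Algebra.EssFiniteType k F] [Algebra.IsSeparable M F] : FiniteDimensional M F := by
  have : Algebra.EssFiniteType M F := Algebra.EssFiniteType.of_comp k M F
  have : Algebra.FormallyUnramified M F := Algebra.FormallyUnramified.of_isSeparable M F
  exact Algebra.FormallyUnramified.finite_of_free M F

/-- In characteristic zero every transcendental element belongs to a separating transcendence
basis. -/
theorem Transcendental.exists_separating {k F : Type*} [Field k] [Field F] [Algebra k F]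
    [CharZero F] {u : F} (hu : Transcendental k u) :
    ∃ L : IntermediateField k F, Transcendental L u ∧ Algebra.IsSeparable L⟮u⟯ F := by
  have hui : AlgebraicIndepOn k id ({u} : Set F) := by
    have : AlgebraicIndependent k (fun i : ({u} : Set F) => (i : F)) :=
      (algebraicIndependent_unique_type_iff (x := fun i : ({u} : Set F) => (i : F))).2 hu
    exact this
  obtain ⟨b, hub, hb⟩ := exists_isTranscendenceBasis_superset hui
  have hu' : u ∈ b := hub rfl
  let L := IntermediateField.adjoin k (b \ {u})
  have hLu : Transcendental L u := fun halg => by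
    have := hb.1.transcendental_adjoin (s := {⟨u, hu'⟩}ᶜ) (i := ⟨u, hu'⟩) (by simp)
    have e : ((↑) : b → F) '' {⟨u, hu'⟩}ᶜ = b \ {u} := by
      ext y; simp
    rw [e] at this
    exact this (IntermediateField.isAlgebraic_adjoin_iff.1 halg)
  have hle : IntermediateField.adjoin k b ≤ L⟮u⟯.restrictScalars k := by
    refine IntermediateField.adjoin_le_iff.2 fun y hy => ?_
    by_cases h : y = u
    · exact h ▸ IntermediateField.mem_adjoin_simple_self L u
    · exact L⟮u⟯.algebraMap_mem ⟨y, IntermediateField.subset_adjoin _ _ ⟨hy, h⟩⟩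
  have hrange : Set.range ((↑) : b → F) = b := Subtype.range_coe
  have h1 : Algebra.IsAlgebraic (Algebra.adjoin k b) F := hrange ▸ hb.isAlgebraic
  have halg : Algebra.IsAlgebraic L⟮u⟯ F := ⟨fun y =>
    (IntermediateField.isAlgebraic_adjoin_iff.2 (h1.isAlgebraic y)).of_ringHom_comm
      (IntermediateField.inclusion hle).toRingHom fun _ => rfl⟩
  have : CharZero L⟮u⟯ := (algebraMap L⟮u⟯ F).charZero
  exact ⟨L, hLu, inferInstance⟩

/-- Write a transcendental element `x` of `F` as a `k`-combination of `p ^ n`-th powers of elements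
`uᵢ`, for `n` as large as possible.  Then one of the `uᵢ` belongs to a separating transcendence
basis of `F` over `k`. -/
theorem exists_pow_expansion_separating {k F : Type*} [Field k] [Field F] [Algebra k F]
    [Algebra.EssFiniteType k F] (p : ℕ) [ExpChar F p]
    (H : p.Prime → ∀ s : Finset F, LinearIndepOn k id (s : Set F) →
      LinearIndepOn k (· ^ p) (s : Set F)) {x : F} (hx : Transcendental k x) :
    ∃ n, x ∈ Submodule.span k (Set.range fun u : F => u ^ p ^ n) ∧
      ∀ (ι : Type) [Fintype ι] (c : ι → k) (u : ι → F), x = ∑ i, c i • u i ^ p ^ n →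
        ∃ i, ∃ L : IntermediateField k F, Transcendental L (u i) ∧
          Algebra.IsSeparable L⟮u i⟯ F ∧ FiniteDimensional L⟮u i⟯ F := by
  suffices h : ∃ n, x ∈ Submodule.span k (Set.range fun u : F => u ^ p ^ n) ∧
      ∀ (ι : Type) [Fintype ι] (c : ι → k) (u : ι → F), x = ∑ i, c i • u i ^ p ^ n →
        ∃ i, ∃ L : IntermediateField k F, Transcendental L (u i) ∧
          Algebra.IsSeparable L⟮u i⟯ F by
    obtain ⟨n, hxn, h⟩ := h
    refine ⟨n, hxn, fun ι _ c u hxu => ?_⟩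
    obtain ⟨i, L, hL, hsep⟩ := h ι c u hxu
    have : Algebra.EssFiniteType L F := Algebra.EssFiniteType.of_comp k L F
    exact ⟨i, L, hL, hsep, finiteDimensional_of_essFiniteType_of_isSeparable L _ F⟩
  rcases (inferInstance : ExpChar F p) with _ | hp
  · refine ⟨0, Submodule.subset_span ⟨x, by simp⟩, fun ι _ c u hxu => ?_⟩
    obtain ⟨i, hi⟩ : ∃ i, Transcendental k (u i) := by
      by_contra! hcon
      refine hx ?_
      rw [hxu]
      have : ∀ i, u i ∈ algebraicClosure k F := fun i =>
        mem_algebraicClosure_iff.2 (not_not.1 (hcon i))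
      refine mem_algebraicClosure_iff.1 (sum_mem fun i _ => ?_)
      rw [Algebra.smul_def]
      exact mul_mem ((algebraicClosure k F).algebraMap_mem _) (pow_mem (this i) _)
    exact ⟨i, hi.exists_separating⟩
  · have : ExpChar k p := (algebraMap k F).expChar (algebraMap k F).injective p
    have : Fact p.Prime := ⟨hp⟩
    obtain ⟨s, hs, hsep⟩ :=
      exists_isTranscendenceBasis_and_isSeparable_of_linearIndepOn_pow_of_essFiniteType p hp (H hp)
    classical
    have hex := exists_notMem_powerField hp s hs hx
    obtain ⟨n, hn⟩ : ∃ n, Nat.find hex = n + 1 := by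
      refine Nat.exists_eq_succ_of_ne_zero fun h0 => ?_
      have := Nat.find_spec hex
      rw [mem_powerField_iff, h0] at this
      exact this (Submodule.subset_span ⟨x, by simp⟩)
    have hxn := Nat.find_min hex (m := n) (by omega)
    rw [not_not, mem_powerField_iff] at hxn
    have hxn1 := Nat.find_spec hex
    rw [hn, mem_powerField_iff] at hxn1
    refine ⟨n, hxn, fun ι _ c u hxu => ?_⟩
    obtain ⟨i, hi⟩ : ∃ i, u i ∉ powerField k F p hp.ne_zero := by
      by_contra! hcon
      apply hxn1
      rw [hxu]
      refine sum_mem fun i _ => Submodule.smul_mem _ _ ?_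
      have hi := (mem_powerField_iff hp.ne_zero).1 (hcon i)
      refine Submodule.span_induction (p := fun w _ =>
        w ^ p ^ n ∈ Submodule.span k (Set.range fun u : F => u ^ p ^ (n + 1))) ?_ ?_ ?_ ?_ hi
      · rintro _ ⟨w, rfl⟩
        exact Submodule.subset_span ⟨w, by simp only [← pow_mul, pow_succ, mul_comm]⟩
      · rw [zero_pow (pow_ne_zero n hp.ne_zero)]
        exact zero_mem _
      · intro a b _ _ ha hb
        rw [add_pow_expChar_pow]
        exact add_mem ha hb
      · intro a b _ hb
        rw [_root_.smul_pow]
        exact Submodule.smul_mem _ _ hb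
    exact ⟨i, exists_separating_of_notMem_powerField hp s hs hi⟩

/-! ### Bivariate polynomials and separable elements -/

theorem Derivation.apply_eval₂ {k E A : Type*} [CommSemiring k] [CommSemiring E] [CommRing A]
    [Algebra k A] (D : Derivation k A A) (ψ : E →+* A) (hψ : ∀ e, D (ψ e) = 0) (t : A) (g : E[X]) :
    D (g.eval₂ ψ t) = (derivative g).eval₂ ψ t * D t := by
  induction g using Polynomial.induction_on' with
  | add g h hg hh => simp only [eval₂_add, map_add, hg, hh, add_mul]
  | monomial n e =>
    have hn : ψ n = n := _root_.map_natCast ψ n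
    simp only [eval₂_monomial, derivative_monomial, Derivation.leibniz, hψ,
      Derivation.leibniz_pow, map_mul, hn, smul_eq_mul, nsmul_eq_mul]
    ring

/-- The chain rule for bivariate polynomials: the polynomial `H` is the partial derivative of `G`
with respect to the inner variable. -/
theorem Polynomial.exists_bivariate_chain_rule (k A : Type*) {E : Type*} [CommSemiring k]
    [CommRing E] [CommRing A] [Algebra k A] (G : E[X][X]) :
    ∃ H : E[X][X], ∀ (D : Derivation k A A) (ψ : E →+* A), (∀ e, D (ψ e) = 0) → ∀ t y : A,
      D (G.eval₂ (eval₂RingHom ψ t) y) =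
        H.eval₂ (eval₂RingHom ψ t) y * D t +
          (derivative G).eval₂ (eval₂RingHom ψ t) y * D y := by
  induction G using Polynomial.induction_on' with
  | add G₁ G₂ h₁ h₂ =>
    obtain ⟨H₁, h₁⟩ := h₁
    obtain ⟨H₂, h₂⟩ := h₂
    refine ⟨H₁ + H₂, fun D ψ hψ t y => ?_⟩
    simp only [eval₂_add, map_add, h₁ D ψ hψ t y, h₂ D ψ hψ t y]
    ring
  | monomial n g =>
    refine ⟨monomial n (derivative g), fun D ψ hψ t y => ?_⟩
    simp only [eval₂_monomial, derivative_monomial, Derivation.leibniz, coe_eval₂RingHom,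
      Derivation.leibniz_pow, D.apply_eval₂ ψ hψ, eval₂_mul, eval₂_natCast, smul_eq_mul,
      nsmul_eq_mul]
    ring

open scoped IntermediateField.algebraAdjoinAdjoin in
/-- An element separable over `E(u)` is a simple root of a polynomial over `E[u]`. -/
theorem IsSeparable.exists_bivariate {E F : Type*} [Field E] [Field F] [Algebra E F] {u w : F}
    (hw : IsSeparable E⟮u⟯ w) :
    ∃ G : E[X][X], G.eval₂ (eval₂RingHom (algebraMap E F) u) w = 0 ∧
      (derivative G).eval₂ (eval₂RingHom (algebraMap E F) u) w ≠ 0 := by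
  let A := Algebra.adjoin E {u}
  let P := minpoly E⟮u⟯ w
  obtain ⟨b, hbA, hb⟩ := IsLocalization.integerNormalization_spec A⁰ P
  set Q := IsLocalization.integerNormalization A⁰ P
  have hb0 : algebraMap A F b ≠ 0 := by
    rw [Ne, FaithfulSMul.algebraMap_eq_zero_iff]
    exact nonZeroDivisors.ne_zero hbA
  let π : E[X] →+* A := (aeval (⟨u, Algebra.subset_adjoin rfl⟩ : A)).toRingHom
  have hπ : Function.Surjective π := by
    rintro ⟨a, ha⟩
    have ha' : a ∈ (aeval u : E[X] →ₐ[E] F).range :=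
      Algebra.adjoin_singleton_eq_range_aeval E u ▸ ha
    obtain ⟨g, hg⟩ := ha'
    refine ⟨g, Subtype.ext (Eq.trans ?_ hg)⟩
    exact (aeval_algebraMap_apply F (⟨u, Algebra.subset_adjoin rfl⟩ : A) g).symm
  obtain ⟨G, hG⟩ := Polynomial.map_surjective π hπ Q
  have hcomp : (algebraMap A F).comp π = eval₂RingHom (algebraMap E F) u := by
    ext
    · simp [π]
    · simp [π]
  have hev : ∀ H : E[X][X], H.eval₂ (eval₂RingHom (algebraMap E F) u) w =
      eval₂ (algebraMap A F) w (H.map π) := fun H => by rw [eval₂_map, hcomp]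
  have hsmul : ∀ H : A[X], eval₂ (algebraMap A F) w H =
      aeval w (H.map (algebraMap A E⟮u⟯)) := fun H => by
    rw [aeval_def, eval₂_map]; rfl
  have hbP : ∀ T : E⟮u⟯[X], aeval w (b • T) = algebraMap A F b * aeval w T := fun T => by
    rw [← algebraMap_smul E⟮u⟯ b T, map_smul, Algebra.smul_def]; rfl
  refine ⟨G, ?_, ?_⟩
  · rw [hev, hG, hsmul, hb, hbP, minpoly.aeval, mul_zero]
  · rw [hev, ← derivative_map, hG, hsmul, ← derivative_map, hb, derivative_smul, hbP]
    exact mul_ne_zero hb0 (hw.aeval_derivative_ne_zero (minpoly.aeval _ _))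

/-! ### Lifts with a prescribed combination -/

/-- Additivity of the `q`-th power, in a ring with basis `z` and structure constants `γ ^ q`. -/
theorem sum_sum_mul_pow_eq {A ι : Type*} [CommRing A] [Fintype ι] (p n : ℕ) [ExpChar A p]
    (z : ι → A) (γ : ι → ι → ι → A)
    (hγ : ∀ k i, z k * z i = ∑ l, γ k i l ^ p ^ n * z l) (b : ι → ι → A) :
    ∑ k, ∑ i, z k * z i * b k i ^ p ^ n =
      ∑ l, z l * (∑ k, ∑ i, γ k i l * b k i) ^ p ^ n := by
  have h : ∀ l, (∑ k, ∑ i, γ k i l * b k i) ^ p ^ n =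
      ∑ k, ∑ i, γ k i l ^ p ^ n * b k i ^ p ^ n := fun l => by
    simp only [sum_pow_char_pow, mul_pow]
  simp only [h, hγ, Finset.mul_sum, Finset.sum_mul]
  symm
  rw [Finset.sum_comm]
  refine Finset.sum_congr rfl fun k _ => ?_
  rw [Finset.sum_comm]
  refine Finset.sum_congr rfl fun i _ => Finset.sum_congr rfl fun l _ => ?_
  ring

theorem MvPolynomial.pderiv_linear {σ R : Type*} [CommRing R] [Fintype σ] [DecidableEq σ]
    (c : σ → R) (y : R) (x : σ) :
    pderiv x (∑ e, C (c e) * X e - C y) = C (c x) := by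
  rw [map_sub, pderiv_C, sub_zero, map_sum, Finset.sum_eq_single x]
  · simp
  · intro e _ he
    rw [Derivation.leibniz, pderiv_C, smul_zero, add_zero, pderiv_X_of_ne he, smul_zero]
  · simp

set_option maxHeartbeats 1000000 in
/-- Let `z` be the basis of a ring, with structure constants `γ ^ q`, that is independent over the
`q`-th powers of `Ω`, and let `x = ∑ z_i v_i ^ q` where `v i₀` is a member of a separating
transcendence basis of `F`. The inclusion `j` of `F` lifts to homomorphisms `θ k : F → R` for which
the combination `∑ z_k θ_k(x)` is any `∑ z_l Y_l ^ q` allowed by the reduction. -/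
theorem exists_lifts {K Ω F R ι : Type*} [Field K] [Field Ω] [Field F] [Algebra K F] [CommRing R]
    [HenselianLocalRing R] (p n : ℕ) [ExpChar K p] (ρ : R →+* Ω) [IsLocalHom ρ]
    (hρ : Function.Surjective ρ) (κ : Ω →+* R) (hκ : ∀ w, ρ (κ w) = w) (j : F →+* Ω)
    [Fintype ι] [DecidableEq ι] (z : ι → K) (γ : ι → ι → ι → K)
    (hγ : ∀ k i, z k * z i = ∑ l, γ k i l ^ p ^ n * z l)
    (hz : ∀ c : ι → Ω, ∑ i, j (algebraMap K F (z i)) * c i ^ p ^ n = 0 → c = 0)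
    (v : ι → F) (i₀ : ι) (L : IntermediateField K F) (hv : Transcendental L (v i₀))
    [FiniteDimensional L⟮v i₀⟯ F] [Algebra.IsSeparable L⟮v i₀⟯ F] (Y : ι → R)
    (hY : ∀ l, ρ (Y l) = ∑ k, ∑ i, j (algebraMap K F (γ k i l) * v i)) :
    ∃ θ : ι → F →+* R, (∀ k x, ρ (θ k x) = j x) ∧
      (∀ k c, θ k (algebraMap K F c) = κ (j (algebraMap K F c))) ∧
      ∑ k, κ (j (algebraMap K F (z k))) * θ k (∑ i, algebraMap K F (z i) * v i ^ p ^ n) =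
        ∑ l, κ (j (algebraMap K F (z l))) * Y l ^ p ^ n := by
  set q := p ^ n with hq
  let jK : K →+* Ω := j.comp (algebraMap K F)
  let κK : K →+* R := κ.comp jK
  let ψ : L →+* R := κ.comp (j.comp (algebraMap L F))
  have : ExpChar Ω p := expChar_of_injective_ringHom jK.injective p
  have : ExpChar R p := expChar_of_injective_ringHom κK.injective p
  have hq0 : q ≠ 0 := pow_ne_zero _ (expChar_pos K p).ne'
  have hunit : ∀ r : R, r ∈ IsLocalRing.maximalIdeal R ↔ ρ r = 0 := fun r => by
    rw [IsLocalRing.mem_maximalIdeal, mem_nonunits_iff, ← isUnit_map_iff ρ,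
      isUnit_iff_ne_zero, not_not]
  have hsep : ∀ i, ∃ G : L[X][X], G.eval₂ (eval₂RingHom (algebraMap L F) (v i₀)) (v i) = 0 ∧
      (derivative G).eval₂ (eval₂RingHom (algebraMap L F) (v i₀)) (v i) ≠ 0 := fun i =>
    (Algebra.IsSeparable.isSeparable L⟮v i₀⟯ (v i)).exists_bivariate
  choose G hG hG' using hsep
  choose H hH using fun i => exists_bivariate_chain_rule R (MvPolynomial (ι × ι) R) (G i)
  -- Evaluating bivariate polynomials in `R`, and reducing.
  have hred : ∀ (P : L[X][X]) (t y : R) (i : ι), ρ t = j (v i₀) → ρ y = j (v i) →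
      ρ (P.eval₂ (eval₂RingHom ψ t) y) =
        j (P.eval₂ (eval₂RingHom (algebraMap L F) (v i₀)) (v i)) := by
    intro P t y i ht hy
    rw [hom_eval₂, hom_eval₂, hy]
    congr 1
    ext e
    · simp [ψ, hκ]
    · simp [ht]
  have hmv : ∀ (P : L[X][X]) (s t : MvPolynomial (ι × ι) R) (b : ι × ι → R),
      MvPolynomial.eval b (P.eval₂ (eval₂RingHom (MvPolynomial.C.comp ψ) s) t) =
        P.eval₂ (eval₂RingHom ψ (MvPolynomial.eval b s)) (MvPolynomial.eval b t) := by
    intro P s t b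
    rw [hom_eval₂]
    congr 1
    ext e
    · simp
    · simp
  -- The unknown with index `(k, i)` is the value `θ k (v i)`.  The equations with `i ≠ i₀` say that
  -- it is algebraic over the value at `v i₀`; those with `i = i₀` prescribe the coordinates of the
  -- combination `∑ z_k θ_k(x)`, of which there are as many as free values `θ k (v i₀)`.
  let f : ι × ι → MvPolynomial (ι × ι) R := fun e =>
    if e.2 = i₀ then
      ∑ e', MvPolynomial.C (κK (γ e'.1 e'.2 e.1)) * MvPolynomial.X e' - MvPolynomial.C (Y e.1)
    else
      (G e.2).eval₂ (eval₂RingHom (MvPolynomial.C.comp ψ) (MvPolynomial.X (e.1, i₀)))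
        (MvPolynomial.X e)
  let a : ι × ι → R := fun e => κ (j (v e.2))
  have ha : ∀ e, MvPolynomial.eval a (f e) ∈ IsLocalRing.maximalIdeal R := by
    rintro ⟨k, i⟩
    rw [hunit]
    by_cases hi : i = i₀
    · simp only [f, hi, if_true, map_sub, map_sum, map_mul, MvPolynomial.eval_C,
        MvPolynomial.eval_X, hY, Fintype.sum_prod_type, a, hκ, κK, jK, RingHom.comp_apply, sub_self]
    · simp only [f, hi, if_false]
      rw [hmv, hred _ _ _ i (by simp [a, hκ]) (by simp [a, hκ]), hG, map_zero]
  have hJ : IsUnit (Matrix.det (Matrix.of fun x e : ι × ι =>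
      MvPolynomial.eval a (MvPolynomial.pderiv x (f e)))) := by
    rw [← isUnit_map_iff ρ, isUnit_iff_ne_zero, RingHom.map_det]
    intro hdet
    obtain ⟨ν, hν0, hν⟩ := Matrix.exists_vecMul_eq_zero_iff.2 hdet
    have hν' : ∀ e, ∑ x, ν x * ρ (MvPolynomial.eval a (MvPolynomial.pderiv x (f e))) = 0 :=
      fun e => congrFun hν e
    let α : ι → Ω := fun i => j ((H i).eval₂ (eval₂RingHom (algebraMap L F) (v i₀)) (v i))
    let β : ι → Ω := fun i =>
      j ((derivative (G i)).eval₂ (eval₂RingHom (algebraMap L F) (v i₀)) (v i))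
    have hβ : ∀ i, β i ≠ 0 := fun i => (_root_.map_ne_zero j).2 (hG' i)
    have h1 : ∀ k i, i ≠ i₀ → α i * ν (k, i₀) + β i * ν (k, i) = 0 := by
      intro k i hi
      rw [← hν' (k, i)]
      have hx : ∀ x, ρ (MvPolynomial.eval a (MvPolynomial.pderiv x (f (k, i)))) =
          α i * (if (k, i₀) = x then 1 else 0) + β i * (if (k, i) = x then 1 else 0) := by
        intro x
        simp only [f, hi, if_false]
        rw [hH i (MvPolynomial.pderiv x) _ (fun e => by simp), map_add, map_mul, map_mul, hmv, hmv,
          map_add, map_mul, map_mul, hred _ _ _ i (by simp [a, hκ]) (by simp [a, hκ]),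
          hred _ _ _ i (by simp [a, hκ]) (by simp [a, hκ])]
        simp only [MvPolynomial.pderiv_X, Pi.single_apply, α, β]
        congr 2 <;> split_ifs <;> simp_all
      simp only [hx, mul_add, Finset.sum_add_distrib]
      simp [mul_comm]
    have h2 : ∀ l, ∑ k, ∑ i, jK (γ k i l) * ν (k, i) = 0 := by
      intro l
      rw [← hν' (l, i₀), Fintype.sum_prod_type]
      refine Finset.sum_congr rfl fun k _ => Finset.sum_congr rfl fun i _ => ?_
      simp only [f, if_true]
      rw [MvPolynomial.pderiv_linear (fun e : ι × ι => κK (γ e.1 e.2 l)), MvPolynomial.eval_C,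
        mul_comm]
      congr 1
      exact (hκ _).symm
    -- A vector in the kernel is determined by its components `ν (k, i₀)`, up to factors `δ i` that
    -- do not depend on `k`, so that the remaining equations factor.
    let δ : ι → Ω := fun i => if i = i₀ then 1 else -(α i / β i)
    have hδ : ∀ k i, ν (k, i) = δ i * ν (k, i₀) := by
      intro k i
      by_cases hi : i = i₀
      · simp [δ, hi]
      · simp only [δ, hi, if_false]
        have := h1 k i hi
        field_simp [hβ i]
        linear_combination this
    have hprod : (∑ i, jK (z i) * δ i ^ q) * (∑ k, jK (z k) * ν (k, i₀) ^ q) = 0 := by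
      have h := sum_sum_mul_pow_eq p n (fun i => jK (z i)) (fun k i l => jK (γ k i l))
        (fun k i => by rw [← map_mul, hγ, map_sum]; simp only [map_mul, map_pow, hq])
        (fun k i => ν (k, i))
      simp only [h2] at h
      rw [← hq, zero_pow hq0] at h
      simp only [mul_zero, Finset.sum_const_zero] at h
      rw [← h, mul_comm, Finset.sum_mul_sum]
      refine Finset.sum_congr rfl fun k _ => Finset.sum_congr rfl fun i _ => ?_
      rw [hδ k i]
      ring
    rcases mul_eq_zero.1 hprod with h | h
    · have := congrFun (hz δ h) i₀
      simp [δ] at this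
    · apply hν0
      have h3 := hz _ h
      ext ⟨k, i⟩
      rw [hδ, show ν (k, i₀) = 0 from congrFun h3 k, mul_zero]
      rfl
  obtain ⟨b, hb, hba⟩ := HenselianLocalRing.exists_root_of_isUnit_det f a ha hJ
  have hρb : ∀ k i, ρ (b (k, i)) = j (v i) := fun k i => by
    have := (hunit _).1 (hba (k, i))
    rwa [map_sub, sub_eq_zero, hκ] at this
  choose θ hθ hθL hθu using fun k => exists_ringHom_lift ρ hρ ψ j (fun e => hκ _) (v i₀) hv
    (b (k, i₀)) (hρb k i₀)
  have hθK : ∀ k c, θ k (algebraMap K F c) = κK c := fun k c => hθL k (algebraMap K L c)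
  have hθv : ∀ k i, θ k (v i) = b (k, i) := by
    intro k i
    by_cases hi : i = i₀
    · rw [hi, hθu]
    let P : R[X] := (G i).map (eval₂RingHom ψ (b (k, i₀)))
    have hρθ : ρ (θ k (v i)) = j (v i) := hθ k _
    -- Both sides are lifts of the same simple root.
    refine IsLocalRing.eq_of_eval_eq_zero_of_not_isUnit_sub (f := P) ?_ ?_ ?_ ?_
    · have hcomp : (θ k).comp (eval₂RingHom (algebraMap L F) (v i₀)) =
          eval₂RingHom ψ (b (k, i₀)) := by
        ext e
        · simpa using hθL k e
        · simp [hθu]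
      rw [eval_map, ← hcomp, ← hom_eval₂, hG, map_zero]
    · have := hb (k, i)
      simp only [f, hi, if_false] at this
      rw [hmv, MvPolynomial.eval_X, MvPolynomial.eval_X] at this
      rw [eval_map, this]
    · rw [← mem_nonunits_iff, ← IsLocalRing.mem_maximalIdeal, hunit, map_sub, hρθ, hρb, sub_self]
    · rw [derivative_map, eval_map, ← isUnit_map_iff ρ, hred _ _ _ i (hρb k i₀) hρθ,
        isUnit_iff_ne_zero]
      exact (_root_.map_ne_zero j).2 (hG' i)
  refine ⟨θ, hθ, hθK, ?_⟩
  have h := sum_sum_mul_pow_eq p n (fun i => κK (z i)) (fun k i l => κK (γ k i l))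
    (fun k i => by rw [← map_mul, hγ, map_sum]; simp only [map_mul, map_pow, hq])
    (fun k i => b (k, i))
  have hY' : ∀ l, ∑ k, ∑ i, κK (γ k i l) * b (k, i) = Y l := by
    intro l
    have := hb (l, i₀)
    simp only [f, if_true, map_sub, map_sum, map_mul, MvPolynomial.eval_C, MvPolynomial.eval_X,
      Fintype.sum_prod_type, sub_eq_zero] at this
    exact this
  simp only [hY'] at h
  refine Eq.trans ?_ h
  refine Finset.sum_congr rfl fun k _ => ?_
  rw [map_sum, Finset.mul_sum]
  refine Finset.sum_congr rfl fun i _ => ?_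
  rw [map_mul, map_pow, hθK, hθv, mul_assoc]
  rfl

/-! ### Bases over the field of powers -/

/-- Let `S` consist of combinations of the `c i` whose coefficients are `q`-th powers, `q = p ^ n`.
The subring generated by `S` and the `q`-th powers has a finite basis `z` over the field of `q`-th
powers, made of products of elements of `S`; and the elements of `S` have coordinates that are
`q`-th powers of linear forms in the roots of their coefficients with respect to `c`. -/
theorem exists_frobenius_basis {K ι₀ : Type*} [Field K] (p n : ℕ) [ExpChar K p] [Fintype ι₀]
    (c : ι₀ → K) (S : Set K) (hS : ∀ s ∈ S, ∃ a : ι₀ → K, s = ∑ i, c i * a i ^ p ^ n) :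
    ∃ (r : ℕ) (z e : Fin r → K) (γ : Fin r → Fin r → Fin r → K) (lam : ι₀ → Fin r → K),
      (∀ k, z k ∈ Submonoid.closure S) ∧
      (∀ a : Fin r → K, ∑ l, z l * a l ^ p ^ n = 0 → a = 0) ∧
      (∀ k i, z k * z i = ∑ l, γ k i l ^ p ^ n * z l) ∧
      ∑ l, z l * e l ^ p ^ n = 1 ∧
      ∀ a : ι₀ → K, ∑ i, c i * a i ^ p ^ n ∈ S →
        ∑ i, c i * a i ^ p ^ n = ∑ l, z l * (∑ i, lam i l * a i) ^ p ^ n := by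
  set q := p ^ n with hq
  have hq0 : q ≠ 0 := pow_ne_zero _ (expChar_pos K p).ne'
  let L : Subfield K := (iterateFrobenius K p n).fieldRange
  have hL : ∀ a : K, a ^ q ∈ L := fun a => ⟨a, iterateFrobenius_def p n a⟩
  have hroot : ∀ x : L, ∃ a : K, a ^ q = x := by
    rintro ⟨_, a, rfl⟩
    exact ⟨a, (iterateFrobenius_def p n a).symm⟩
  choose rt hrt using hroot
  let A := Algebra.adjoin L S
  let M : Submodule L K := Submodule.span L (Submonoid.closure S : Set K)
  have hAM : Subalgebra.toSubmodule A = M := Algebra.adjoin_eq_span L S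
  have hfin : FiniteDimensional L M := by
    have hint : ∀ x : K, IsIntegral L x := fun x =>
      ⟨X ^ q - C ⟨x ^ q, hL x⟩, monic_X_pow_sub_C _ hq0, by
        rw [eval₂_sub, eval₂_pow, eval₂_X, eval₂_C]
        exact sub_self _⟩
    have hfg := fg_adjoin_of_finite (R := L) (Set.finite_range c) fun x _ => hint x
    have : FiniteDimensional L (Subalgebra.toSubmodule (Algebra.adjoin L (Set.range c))) :=
      Module.Finite.iff_fg.2 hfg
    refine Submodule.finiteDimensional_of_le
      (S₂ := Subalgebra.toSubmodule (Algebra.adjoin L (Set.range c))) ?_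
    rw [← hAM]
    refine Subalgebra.toSubmodule.monotone (Algebra.adjoin_le fun s hs => ?_)
    obtain ⟨a, rfl⟩ := hS s hs
    refine sum_mem fun i _ => mul_mem (Algebra.subset_adjoin ⟨i, rfl⟩) ?_
    exact (Algebra.adjoin L (Set.range c)).algebraMap_mem ⟨_, hL (a i)⟩
  obtain ⟨b, hbS, hbM, hbL⟩ := exists_linearIndependent L (Submonoid.closure S : Set K)
  have hrange : Submodule.span L (Set.range ((↑) : b → K)) = M := by
    rw [Subtype.range_coe]; exact hbM
  let B₀ : Module.Basis b L M := (Module.Basis.span hbL).map (LinearEquiv.ofEq _ _ hrange)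
  have hB₀ : ∀ i, (B₀ i : K) = i := fun i => by
    simp [B₀, Module.Basis.span_apply]
  have : Finite b := Module.Finite.finite_basis B₀
  have := Fintype.ofFinite b
  let B := B₀.reindex (Fintype.equivFin b)
  let z : Fin (Fintype.card b) → K := fun k => B k
  have hzS : ∀ k, z k ∈ Submonoid.closure S := fun k => by
    simp only [z, B, Module.Basis.reindex_apply, hB₀]
    exact hbS (Subtype.coe_prop _)
  have hexp : ∀ m : M, (m : K) = ∑ l, z l * rt (B.repr m l) ^ q := fun m => by
    conv_lhs => rw [← B.sum_repr m]
    rw [Submodule.coe_sum]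
    refine Finset.sum_congr rfl fun l _ => ?_
    rw [hrt, Submodule.coe_smul, mul_comm]
    rfl
  have hcl : ∀ x ∈ Submonoid.closure S, x ∈ M := fun x hx => Submodule.subset_span hx
  -- A projection to `M` fixes `S` and turns the coefficients `c i` into elements of `M`.
  obtain ⟨π, hπ⟩ := LinearMap.exists_leftInverse_of_injective M.subtype M.ker_subtype
  have hπ' : ∀ m : M, π m = m := fun m => DFunLike.congr_fun hπ m
  refine ⟨_, z, fun l => rt (B.repr ⟨1, hcl 1 (one_mem _)⟩ l),
    fun k i l => rt (B.repr ⟨z k * z i, hcl _ (mul_mem (hzS k) (hzS i))⟩ l),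
    fun i l => rt (B.repr (π (c i)) l), hzS, ?_, ?_, ?_, ?_⟩
  · intro a ha
    have h1 : ∑ l, (⟨a l ^ q, hL _⟩ : L) • B l = 0 := by
      apply Subtype.ext
      rw [Submodule.coe_sum, Submodule.coe_zero, ← ha]
      exact Finset.sum_congr rfl fun l _ => mul_comm _ _
    have h2 := Fintype.linearIndependent_iff.1 B.linearIndependent _ h1
    ext l
    exact pow_eq_zero_iff hq0 |>.1 (congrArg Subtype.val (h2 l))
  · intro k i
    exact (hexp ⟨z k * z i, hcl _ (mul_mem (hzS k) (hzS i))⟩).trans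
      (Finset.sum_congr rfl fun l _ => mul_comm _ _)
  · exact (hexp ⟨1, hcl 1 (one_mem _)⟩).symm
  · intro a ha
    set s := ∑ i, c i * a i ^ q with hs
    have h1 : s = π s := by
      rw [show π s = _ from hπ' ⟨s, hcl s (Submonoid.subset_closure ha)⟩]
    have h2 : ∀ l, (∑ i, rt (B.repr (π (c i)) l) * a i) ^ q = (B.repr (π s) l : K) := by
      intro l
      have h3 : s = ∑ i, (⟨a i ^ q, hL _⟩ : L) • c i :=
        Finset.sum_congr rfl fun i _ => mul_comm _ _
      have hsum : ∀ w : ι₀ → K, (∑ i, w i) ^ q = ∑ i, w i ^ q := fun w => sum_pow_char_pow p n _ w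
      rw [h3, hsum]
      simp only [map_sum, map_smul, Finsupp.coe_finsetSum, Finset.sum_apply, Finsupp.smul_apply,
        smul_eq_mul, mul_pow]
      rw [AddSubmonoidClass.coe_finsetSum]
      refine Finset.sum_congr rfl fun i _ => ?_
      rw [hrt, mul_comm]
      rfl
    simp only [h2]
    conv_lhs => rw [h1, hexp]
    simp only [hrt]

/-- Linear independence over the `p`-th powers that persists in `F` makes the Frobenius of `F`
preserve linear independence over `K`. -/
theorem linearIndepOn_pow_of_forall {K F : Type*} [Field K] [Field F] [Algebra K F] (p : ℕ)
    [ExpChar K p]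
    (h : ∀ (r : ℕ) (z : Fin r → K), (∀ a : Fin r → K, ∑ l, z l * a l ^ p = 0 → a = 0) →
      ∀ a : Fin r → F, ∑ l, algebraMap K F (z l) * a l ^ p = 0 → a = 0)
    (s : Finset F) (hs : LinearIndepOn K id (s : Set F)) :
    LinearIndepOn K (· ^ p) (s : Set F) := by
  have : ExpChar F p := expChar_of_injective_ringHom (algebraMap K F).injective p
  have hs' : LinearIndependent K (fun i : s => (i : F)) := hs
  change LinearIndependent K (fun i : s => (i : F) ^ p)
  rw [Fintype.linearIndependent_iff] at hs' ⊢
  intro g hg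
  -- The coefficients `g` of a relation are expanded in a basis over the `p`-th powers.
  obtain ⟨r, z, -, -, lam, -, hz, -, -, hlam⟩ := exists_frobenius_basis p 1 g (Set.range g) (by
    classical
    rintro _ ⟨i, rfl⟩
    refine ⟨Pi.single i 1, ?_⟩
    rw [Finset.sum_eq_single i]
    · simp
    · intro k _ hk
      simp [Pi.single_eq_of_ne hk, (expChar_pos K p).ne']
    · simp)
  simp only [pow_one] at hz hlam
  have hgi : ∀ i, g i = ∑ l, z l * lam i l ^ p := fun i => by
    classical
    have h1 : ∑ k, g k * (Pi.single i 1 : s → K) k ^ p = g i := by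
      rw [Finset.sum_eq_single i]
      · simp
      · intro k _ hk
        simp [Pi.single_eq_of_ne hk, (expChar_pos K p).ne']
      · simp
    have h2 := hlam (Pi.single i 1) (by rw [h1]; exact ⟨i, rfl⟩)
    rw [h1] at h2
    rw [h2]
    refine Finset.sum_congr rfl fun l _ => ?_
    congr 2
    simp [Pi.single_apply]
  have h0 := h r z hz (fun l => ∑ i, algebraMap K F (lam i l) * i) (by
    have hF : ∀ l, (∑ i : s, algebraMap K F (lam i l) * (i : F)) ^ p =
        ∑ i : s, algebraMap K F (lam i l) ^ p * (i : F) ^ p := fun l => by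
      simp only [sum_pow_char, mul_pow]
    simp only [hF, Finset.mul_sum]
    rw [Finset.sum_comm, ← hg]
    refine Finset.sum_congr rfl fun i _ => ?_
    rw [hgi, Algebra.smul_def, map_sum, Finset.sum_mul]
    simp only [map_mul, map_pow, mul_assoc])
  intro i
  rw [hgi]
  refine Finset.sum_eq_zero fun l _ => ?_
  have h1 := hs' (fun i => lam i l) (by
    simp only [Algebra.smul_def]
    exact congrFun h0 l) i
  rw [h1, zero_pow (expChar_pos K p).ne', mul_zero]

/-! ### Ultrapowers -/

/-- The ultrapower of `K` as an algebra over `K`, along the diagonal embedding. -/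
noncomputable instance Filter.Germ.instAlgebraSelf {S K : Type*} [Field K] (l : Filter S) :
    Algebra K (l.Germ K) where
  toSMul := inferInstance
  algebraMap := (Germ.coeRingHom l).comp (Pi.constRingHom S K)
  commutes' _ _ := mul_comm _ _
  smul_def' _ g := Germ.inductionOn g fun _ => rfl

theorem Filter.Germ.aeval_coe {S K β : Type*} [Field K] (l : Filter S) (ξ : β → S → K)
    (P : MvPolynomial β K) :
    MvPolynomial.aeval (fun b => (ξ b : l.Germ K)) P =
      ((fun s => MvPolynomial.eval (fun b => ξ b s) P : S → K) :) := by
  induction P using MvPolynomial.induction_on with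
  | C c => simp only [MvPolynomial.aeval_C, MvPolynomial.eval_C]; rfl
  | add P Q hP hQ => simp only [map_add, hP, hQ]; rfl
  | mul_X P b hP => simp only [map_mul, hP, MvPolynomial.aeval_X, MvPolynomial.eval_X]; rfl

/-- Linear independence over the field of `q`-th powers of `K` persists in the ultrapower, for the
coefficients `a l ^ q`. -/
theorem Filter.Germ.eq_zero_of_frobenius_sum_eq_zero {S K ι : Type*} [Field K] [Fintype ι]
    (U : Ultrafilter S) (q : ℕ) (z : ι → K)
    (hz : ∀ a : ι → K, ∑ l, z l * a l ^ q = 0 → a = 0) (a : ι → (U : Filter S).Germ K)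
    (ha : ∑ l, algebraMap K _ (z l) * a l ^ q = 0) : a = 0 := by
  choose f hf using fun l => Germ.coeRingHom_surjective (U : Filter S) (a l)
  have h1 : ((fun s => ∑ l, z l * f l s ^ q : S → K) : (U : Filter S).Germ K) = 0 := by
    rw [← ha]
    have : (fun s => ∑ l, z l * f l s ^ q : S → K) =
        ∑ l, Pi.constRingHom S K (z l) * f l ^ q := by
      ext s; simp
    rw [this]
    change Germ.coeRingHom (U : Filter S) _ = _
    rw [map_sum]
    simp only [map_mul, map_pow, hf]
    rfl
  have h2 := Germ.coe_eq.1 (show _ = ((fun _ => 0 : S → K) : (U : Filter S).Germ K) from h1)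
  ext l
  rw [← hf l]
  refine Germ.coe_eq.2 ?_
  filter_upwards [h2] with s hs
  exact congrFun (hz _ hs) l

/-- Along an ultrafilter without finite sets, the identity becomes a transcendental element of the
ultrapower. -/
theorem Filter.Germ.transcendental_coe {K : Type*} [Field K] (X : Set K) [Infinite X] :
    Transcendental K (((↑) : X → K) : (hyperfilter X : Filter X).Germ K) := by
  rw [transcendental_iff]
  intro P hP
  by_contra hP0
  have h1 : aeval ((((↑) : X → K) : (hyperfilter X : Filter X).Germ K)) P =
      ((fun s => P.eval (s : K) : X → K) :) := by
    let e : K[X] →+* (hyperfilter X : Filter X).Germ K :=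
      (Germ.coeRingHom _).comp (RingHom.pi fun s : X => evalRingHom (s : K))
    change (aeval _ : K[X] →ₐ[K] _).toRingHom P = e P
    congr 1
    ext c
    · simp only [AlgHom.toRingHom_eq_coe, RingHom.comp_apply, RingHom.coe_coe, aeval_C, e]
      change _ = (((fun s : X => eval (s : K) (C c)) : X → K) : (hyperfilter X : Filter X).Germ K)
      simp only [eval_C]
      rfl
    · simp only [AlgHom.toRingHom_eq_coe, RingHom.coe_coe, aeval_X, e]
      change _ = (((fun s : X => eval (s : K) Polynomial.X) : X → K) :
        (hyperfilter X : Filter X).Germ K)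
      simp only [eval_X]
  rw [h1] at hP
  have h2 := Germ.coe_eq.1 (show _ = ((fun _ => 0 : X → K) : (hyperfilter X : Filter X).Germ K)
    from hP)
  have h3 : {s : X | P.eval (s : K) = 0}.Finite := by
    have : {s : K | P.eval s = 0}.Finite := P.finite_setOfPred_isRoot hP0
    exact this.preimage Subtype.val_injective.injOn
  exact notMem_hyperfilter_of_finite h3 h2

/-- Homomorphisms that lift the inclusion of a field into the ultrapower transport the truth of
polynomial equations and inequations to nearby points. -/
theorem NearbyGerm.eventually_eval_eq_zero_iff {K S Y F β : Type*} [TopologicalSpace Y] [Field K]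
    [TopologicalSpace K] [IsTopologicalDivisionRing K] [T1Space K] (U : Ultrafilter S) (y₀ : S → Y)
    [Field F] [Algebra K F] (j : F →+* (U : Filter S).Germ K)
    (hj : ∀ c, j (algebraMap K F c) = algebraMap K _ c) (θ : F →+* NearbyGerm K U y₀)
    (hθ : ∀ x, residue U y₀ (θ x) = j x)
    (hθK : ∀ c, θ (algebraMap K F c) = const U y₀ (algebraMap K _ c))
    (η : β → F) (ξ : β → S → K) (hξ : ∀ b, j (η b) = (ξ b : (U : Filter S).Germ K))
    (fam : β → families K y₀) (hfam : ∀ b, θ (η b) = Ideal.Quotient.mk _ (fam b))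
    (P : MvPolynomial β K) :
    ∀ᶠ s in U, ∀ᶠ y in 𝓝 (y₀ s), MvPolynomial.eval (fun b => (fam b).1 s y) P = 0 ↔
      MvPolynomial.eval (fun b => ξ b s) P = 0 := by
  let ev : MvPolynomial β K →+* families K y₀ :=
    MvPolynomial.eval₂Hom ((constFamily y₀).comp (Pi.constRingHom S K)) fam
  have hev : ∀ s y, (ev P).1 s y = MvPolynomial.eval (fun b => (fam b).1 s y) P := by
    intro s y
    rw [← eval_apply]
    change ((eval y₀ s y).comp ev) P = _
    congr 1
    ext b <;> simp [ev]; rfl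
  have hθev : θ (MvPolynomial.aeval η P) = Ideal.Quotient.mk _ (ev P) := by
    change (θ.comp (MvPolynomial.aeval η).toRingHom) P = ((Ideal.Quotient.mk _).comp ev) P
    congr 1
    ext b
    · simp only [ev, RingHom.comp_apply, AlgHom.toRingHom_eq_coe, RingHom.coe_coe,
        MvPolynomial.algHom_C, hθK, MvPolynomial.coe_eval₂Hom, MvPolynomial.eval₂_C]
      exact const_coe U y₀ _
    · simp [ev, hfam]
  have hjev : j (MvPolynomial.aeval η P) =
      ((fun s => MvPolynomial.eval (fun b => ξ b s) P : S → K) :) := by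
    rw [← Germ.aeval_coe]
    change (j.comp (MvPolynomial.aeval η).toRingHom) P = (MvPolynomial.aeval _).toRingHom P
    congr 1
    ext b
    · simp [hj]
    · simp [hξ]
  by_cases h : MvPolynomial.aeval η P = 0
  · have h1 : ∀ᶠ s in U, ∀ᶠ y in 𝓝 (y₀ s), (ev P).1 s y = 0 := by
      rw [← mk_eq_zero_iff, ← hθev, h, map_zero]
    have h2 : ∀ᶠ s in U, MvPolynomial.eval (fun b => ξ b s) P = 0 := by
      rw [h, map_zero] at hjev
      exact Germ.coe_eq.1 hjev.symm
    filter_upwards [h1, h2] with s hs1 hs2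
    filter_upwards [hs1] with y hy
    rw [← hev, hy, hs2]
  · have hj0 : j (MvPolynomial.aeval η P) ≠ 0 := (_root_.map_ne_zero j).2 h
    have h1 : ∀ᶠ s in U, (ev P).1 s (y₀ s) ≠ 0 := by
      by_contra hcon
      rw [← Ultrafilter.eventually_not] at hcon
      apply hj0
      rw [← hθ, hθev, residue_mk]
      refine Germ.coe_eq.2 ?_
      filter_upwards [hcon] with s hs
      exact not_not.1 hs
    have h2 : ∀ᶠ s in U, MvPolynomial.eval (fun b => ξ b s) P ≠ 0 := by
      by_contra hcon
      rw [← Ultrafilter.eventually_not] at hcon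
      apply hj0
      rw [hjev]
      refine Germ.coe_eq.2 ?_
      filter_upwards [hcon] with s hs
      exact not_not.1 hs
    filter_upwards [h1, h2] with s hs1 hs2
    filter_upwards [((ev P).2 s).eventually_ne hs1] with y hy
    rw [← hev]
    exact iff_of_false hy hs2

/-! ### Nearby points of a set -/

/-- The lifts of a field of germs to nearby points, given a basis `z` of a ring over the field of
`q`-th powers and an expansion `η b₀ = ∑ z_i v_i ^ q` such that `v i₀` is a member of a separating
transcendence basis. -/
theorem exists_nearby_families_of_separating {K Γ₀ F S β : Type*} [Field K]
    [LinearOrderedCommGroupWithZero Γ₀]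
    [Valued K Γ₀] [HenselianLocalRing (Valued.v : Valuation K Γ₀).valuationSubring]
    (p n : ℕ) [ExpChar K p] (U : Ultrafilter S) [Field F] [Algebra K F]
    (j : F →+* (U : Filter S).Germ K) (hjK : ∀ c, j (algebraMap K F c) = algebraMap K _ c)
    (η : β → F) (ξ : β → S → K) (hη : ∀ b, j (η b) = (ξ b : (U : Filter S).Germ K)) (b₀ : β) {r : ℕ}
    (z : Fin r → K) (γ : Fin r → Fin r → Fin r → K)
    (hz : ∀ a : Fin r → K, ∑ l, z l * a l ^ p ^ n = 0 → a = 0)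
    (hγ : ∀ k i, z k * z i = ∑ l, γ k i l ^ p ^ n * z l)
    (v : Fin r → F) (hv : η b₀ = ∑ l, algebraMap K F (z l) * v l ^ p ^ n)
    (i₀ : Fin r) (L : IntermediateField K F) (hL : Transcendental L (v i₀))
    [FiniteDimensional L⟮v i₀⟯ F] [Algebra.IsSeparable L⟮v i₀⟯ F] :
    ∃ (y₀ : S → Fin r → K) (fam : Fin r → β → NearbyGerm.families K y₀),
      (∀ᶠ s in U, ∀ᶠ y in 𝓝 (y₀ s),
        ∑ k, z k * (fam k b₀).1 s y = ∑ l, z l * y l ^ p ^ n) ∧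
      ∀ (k : Fin r) (P : MvPolynomial β K), ∀ᶠ s in U, ∀ᶠ y in 𝓝 (y₀ s),
        MvPolynomial.eval (fun b => (fam k b).1 s y) P = 0 ↔
          MvPolynomial.eval (fun b => ξ b s) P = 0 := by
  let φ : (S → K) →+* (U : Filter S).Germ K := Germ.coeRingHom (U : Filter S)
  have hφ : ∀ a, φ (Pi.constRingHom S K a) = algebraMap K _ a := fun a => rfl
  choose v' hv' using fun i => show ∃ g, φ g = _ from
    Germ.coeRingHom_surjective (U : Filter S) (j (v i))
  -- The values of the coordinates at which the homomorphisms `θ k` reduce to the inclusion.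
  let y₀ : S → Fin r → K := fun s l => ∑ k, ∑ i, γ k i l * v' i s
  let coord : Fin r → NearbyGerm.families K y₀ := fun l =>
    ⟨fun _ y => y l, fun s => (continuous_apply l).continuousAt⟩
  have hsurj : Function.Surjective (NearbyGerm.residue (K := K) U y₀) := fun g =>
    ⟨NearbyGerm.const U y₀ g, NearbyGerm.residue_const U y₀ g⟩
  have hz' : ∀ a : Fin r → (U : Filter S).Germ K,
      ∑ l, j (algebraMap K F (z l)) * a l ^ p ^ n = 0 → a = 0 := fun a ha =>
    Filter.Germ.eq_zero_of_frobenius_sum_eq_zero U _ z hz a (by simpa only [hjK] using ha)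
  have hcoord : ∀ l, NearbyGerm.residue U y₀ (Ideal.Quotient.mk _ (coord l)) =
      ∑ k, ∑ i, j (algebraMap K F (γ k i l) * v i) := fun l => by
    have h1 : ∑ k, ∑ i, j (algebraMap K F (γ k i l) * v i) =
        φ (∑ k, ∑ i, Pi.constRingHom S K (γ k i l) * v' i) := by
      simp only [map_sum, map_mul, hjK, hv', hφ]
    rw [h1, NearbyGerm.residue_mk]
    refine congrArg φ ?_
    ext s
    simp [coord, y₀]
  have hlifts := exists_lifts (K := K) (F := F) (ι := Fin r) p n (NearbyGerm.residue (K := K) U y₀)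
    hsurj (NearbyGerm.const U y₀) (NearbyGerm.residue_const U y₀) j z γ hγ
  obtain ⟨θ, hθ, hθK, hθsum⟩ := hlifts hz' v i₀ L hL (fun l => Ideal.Quotient.mk _ (coord l)) hcoord
  choose fam hfam using fun k b => Ideal.Quotient.mk_surjective (θ k (η b))
  refine ⟨y₀, fam, ?_,
    fun k P => NearbyGerm.eventually_eval_eq_zero_iff U y₀ j hjK (θ k) (hθ k)
      (fun c => by rw [hθK, hjK]) η ξ hη
      (fam k) (fun b => (hfam k b).symm) P⟩
  have hc : ∀ a : K, NearbyGerm.const U y₀ (j (algebraMap K F a)) =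
      Ideal.Quotient.mk _ (NearbyGerm.constFamily y₀ (fun _ => a)) := fun a =>
    (congrArg _ (hjK a)).trans (NearbyGerm.const_coe U y₀ _)
  rw [← hv] at hθsum
  simp only [hc, ← hfam, ← map_mul, ← map_pow, ← map_sum] at hθsum
  rw [NearbyGerm.mk_eq_mk_iff] at hθsum
  filter_upwards [hθsum] with s hs
  filter_upwards [hs] with y hy
  rw [← NearbyGerm.eval_apply y₀ s y, ← NearbyGerm.eval_apply y₀ s y] at hy
  simp only [map_sum, map_mul, map_pow] at hy
  exact hy

/-- Nearby points.  Let `ξ b`, for `b` in a finite set, be functions on an infinite set `X ⊆ K`, one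
of them the inclusion.  For almost every `s ∈ X` there are functions `fam k b` near a point `y₀ s`,
such that each tuple `(fam k b s y)_b` satisfies a given polynomial equation if and only if
`(ξ b s)_b` does, while a fixed combination of the values `fam k b₀ s y` is the element
`∑ z_l y_l ^ q`, for `q = p ^ n` and arbitrary `y` near `y₀ s`. -/
theorem exists_nearby_families {K Γ₀ β : Type*} [Field K] [LinearOrderedCommGroupWithZero Γ₀]
    [Valued K Γ₀] [HenselianLocalRing (Valued.v : Valuation K Γ₀).valuationSubring]
    (p : ℕ) [ExpChar K p] [Finite β] (X : Set K) [Infinite X] (ξ : β → X → K) (b₀ : β)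
    (hb₀ : ∀ s, ξ b₀ s = s) :
    ∃ (n r : ℕ) (z e : Fin r → K), (∀ k, z k ∈ Submonoid.closure X) ∧
      ∑ l, z l * e l ^ p ^ n = 1 ∧
      ∃ (y₀ : X → Fin r → K) (fam : Fin r → β → NearbyGerm.families K y₀),
        (∀ᶠ s in hyperfilter X, ∀ᶠ y in 𝓝 (y₀ s),
          ∑ k, z k * (fam k b₀).1 s y = ∑ l, z l * y l ^ p ^ n) ∧
        ∀ (k : Fin r) (P : MvPolynomial β K), ∀ᶠ s in hyperfilter X, ∀ᶠ y in 𝓝 (y₀ s),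
          MvPolynomial.eval (fun b => (fam k b).1 s y) P = 0 ↔
            MvPolynomial.eval (fun b => ξ b s) P = 0 := by
  classical
  let U := hyperfilter X
  let Ω := (U : Filter X).Germ K
  let F : IntermediateField K Ω := IntermediateField.adjoin K (Set.range fun b => (ξ b : Ω))
  let j : F →+* Ω := algebraMap F Ω
  let η : β → F := fun b => ⟨(ξ b : Ω), IntermediateField.subset_adjoin _ _ ⟨b, rfl⟩⟩
  have hη : ∀ b, j (η b) = (ξ b : Ω) := fun b => rfl
  have hjK : ∀ c, j (algebraMap K F c) = algebraMap K Ω c := fun c => rfl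
  have hess : Algebra.EssFiniteType K F :=
    IntermediateField.essFiniteType_iff.2 
      ⟨(Set.finite_range fun b => (ξ b : Ω)).toFinset, by rw [Set.Finite.coe_toFinset]⟩
  have : ExpChar F p := expChar_of_injective_ringHom (algebraMap K F).injective p
  have hx : Transcendental K (η b₀) := by
    intro h
    have h1 : IsAlgebraic K (j (η b₀)) := h.algebraMap
    rw [hη, show ξ b₀ = ((↑) : X → K) from funext hb₀] at h1
    exact Filter.Germ.transcendental_coe X h1
  obtain ⟨n, hxn, hsep⟩ := exists_pow_expansion_separating p (fun _ s hs =>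
    linearIndepOn_pow_of_forall p (fun r z hz a ha => by
      have h1 := Filter.Germ.eq_zero_of_frobenius_sum_eq_zero U p z hz (fun l => j (a l)) (by
        have h0 := congrArg j ha
        simp only [map_sum, map_mul, map_pow, map_zero, hjK] at h0
        exact h0)
      ext l
      exact congrArg _ (j.injective ((congrFun h1 l).trans (map_zero j).symm))) s hs) hx
  set q := p ^ n with hq
  let φ : (X → K) →+* Ω := Germ.coeRingHom (U : Filter X)
  have hφ : ∀ a, φ (Pi.constRingHom X K a) = algebraMap K Ω a := fun a => rfl
  -- Expand the generic element with respect to `q`-th powers and spread out over `X`.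
  obtain ⟨N, c, u, hcu⟩ : ∃ (N : ℕ) (c : Fin N → K) (u : Fin N → F),
      η b₀ = ∑ i, algebraMap K F (c i) * u i ^ q := by
    obtain ⟨N, c, w, hw⟩ := Submodule.mem_span_set'.1 hxn
    choose u hu using fun i => (w i).2
    refine ⟨N, c, u, ?_⟩
    rw [← hw]
    exact Finset.sum_congr rfl fun i _ => by rw [Algebra.smul_def, ← hu]
  choose u' hu' using fun i => show ∃ g, φ g = _ from
    Germ.coeRingHom_surjective (U : Filter X) (j (u i))
  have hu'' : ∀ᶠ s : X in U, (s : K) = ∑ i, c i * u' i s ^ q := by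
    have h1 : j (∑ i, algebraMap K F (c i) * u i ^ q) =
        φ (∑ i, Pi.constRingHom X K (c i) * u' i ^ q) := by
      simp only [map_sum, map_mul, map_pow, hjK, hu', hφ]
    rw [← hcu, hη, show ξ b₀ = ((↑) : X → K) from funext hb₀] at h1
    filter_upwards [Germ.coe_eq.1 h1] with s hs
    rw [hs]
    simp
  -- The set `S` contains `U`-almost all elements of `X`.
  let S : Set K := {s | s ∈ X ∧ ∃ a : Fin N → K, s = ∑ i, c i * a i ^ q}
  obtain ⟨r, z, e, γ, lam, hzS, hz, hγ, he, hlam⟩ :=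
    exists_frobenius_basis p n c S fun s hs => hs.2
  let v : Fin r → F := fun l => ∑ i, algebraMap K F (lam i l) * u i
  have hv : η b₀ = ∑ l, algebraMap K F (z l) * v l ^ q := by
    apply j.injective
    have h1 : j (∑ l, algebraMap K F (z l) * v l ^ q) = φ (∑ l, Pi.constRingHom X K (z l) *
        (∑ i, Pi.constRingHom X K (lam i l) * u' i) ^ q) := by
      simp only [v, map_sum, map_mul, map_pow, hjK, hu', hφ]
    rw [h1, hη, show ξ b₀ = ((↑) : X → K) from funext hb₀]
    refine Germ.coe_eq.2 ?_
    filter_upwards [hu''] with s hs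
    have h2 := hlam (fun i => u' i s) (by rw [← hs]; exact ⟨s.2, _, hs⟩)
    rw [← hs] at h2
    rw [h2]
    simp [hq]
  obtain ⟨i₀, L, hL, hLsep, hLfin⟩ := hsep (Fin r) z v (by simpa only [Algebra.smul_def] using hv)
  obtain ⟨y₀, fam, h1, h2⟩ := exists_nearby_families_of_separating p n U j hjK η ξ hη b₀ z γ hz hγ v
    hv i₀ L hL
  exact ⟨n, r, z, e, fun k => Submonoid.closure_mono (fun s hs => hs.1) (hzS k), he, y₀, fam,
    h1, h2⟩

/-! ### Existential formulas -/

section Formulas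

open FirstOrder FirstOrder.Language

/-- The terms of the language of rings are polynomials; `σ` is substituted for their variables. -/
theorem FirstOrder.Ring.exists_eval_eq_realize {K V β : Type*} [Field K]
    [FirstOrder.Ring.CompatibleRing K] (σ : V → MvPolynomial β K) (t : Language.ring.Term V) :
    ∃ P : MvPolynomial β K, ∀ x : β → K,
      t.realize (fun a => MvPolynomial.eval x (σ a)) = MvPolynomial.eval x P := by
  induction t with
  | var a => exact ⟨σ a, fun x => rfl⟩
  | func f ts ih =>
    choose P hP using ih
    cases f with
    | add =>
      refine ⟨P 0 + P 1, fun x => ?_⟩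
      rw [map_add, ← hP, ← hP]
      exact CompatibleRing.funMap_add _
    | mul =>
      refine ⟨P 0 * P 1, fun x => ?_⟩
      rw [map_mul, ← hP, ← hP]
      exact CompatibleRing.funMap_mul _
    | neg =>
      refine ⟨-P 0, fun x => ?_⟩
      rw [map_neg, ← hP]
      exact CompatibleRing.funMap_neg _
    | zero =>
      refine ⟨0, fun x => ?_⟩
      rw [map_zero]
      exact CompatibleRing.funMap_zero _
    | one =>
      refine ⟨1, fun x => ?_⟩
      rw [map_one]
      exact CompatibleRing.funMap_one _

/-- Points that satisfy the same polynomial equations satisfy the same quantifier-free formulas;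
the version for families of points along filters. -/
theorem FirstOrder.Ring.eventually_realize_iff_of_isQF {K S Y α β : Type*} [Field K]
    [FirstOrder.Ring.CompatibleRing K] (U : Filter S) (l : S → Filter Y) (g : S → Y → β → K)
    (ξ : S → β → K)
    (h : ∀ P : MvPolynomial β K, ∀ᶠ s in U, ∀ᶠ y in l s,
      MvPolynomial.eval (g s y) P = 0 ↔ MvPolynomial.eval (ξ s) P = 0)
    {m : ℕ} (σ : α ⊕ Fin m → MvPolynomial β K) {ψ : Language.ring.BoundedFormula α m}
    (hψ : ψ.IsQF) :
    ∀ᶠ s in U, ∀ᶠ y in l s,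
      ψ.Realize (fun a => MvPolynomial.eval (g s y) (σ (Sum.inl a)))
          (fun i => MvPolynomial.eval (g s y) (σ (Sum.inr i))) ↔
        ψ.Realize (fun a => MvPolynomial.eval (ξ s) (σ (Sum.inl a)))
          (fun i => MvPolynomial.eval (ξ s) (σ (Sum.inr i))) := by
  induction hψ with
  | falsum => exact Eventually.of_forall fun s => Eventually.of_forall fun y => Iff.rfl
  | of_isAtomic hψ =>
    cases hψ with
    | equal t₁ t₂ =>
      obtain ⟨P₁, h₁⟩ := exists_eval_eq_realize σ t₁
      obtain ⟨P₂, h₂⟩ := exists_eval_eq_realize σ t₂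
      have key : ∀ x : β → K, (t₁.bdEqual t₂).Realize
          (fun a => MvPolynomial.eval x (σ (Sum.inl a)))
          (fun i => MvPolynomial.eval x (σ (Sum.inr i))) ↔
          MvPolynomial.eval x (P₁ - P₂) = 0 := fun x => by
        have : Sum.elim (fun a => MvPolynomial.eval x (σ (Sum.inl a)))
            (fun i => MvPolynomial.eval x (σ (Sum.inr i))) =
            fun a => MvPolynomial.eval x (σ a) := by
          ext a; cases a <;> rfl
        rw [BoundedFormula.realize_bdEqual, this, h₁, h₂, map_sub, sub_eq_zero]
      simpa only [key] using h (P₁ - P₂)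
    | rel R _ => exact isEmptyElim R
  | imp _ _ h₁ h₂ =>
    filter_upwards [h₁, h₂] with s hs₁ hs₂
    filter_upwards [hs₁, hs₂] with y hy₁ hy₂
    rw [BoundedFormula.realize_imp, BoundedFormula.realize_imp, hy₁, hy₂]

/-- An existential formula asks for witnesses of a quantifier-free formula; the variables of the
latter extend those of the former. -/
theorem FirstOrder.Language.BoundedFormula.IsExistential.exists_isQF {L : Language} {α : Type*}
    {n : ℕ} {φ : L.BoundedFormula α n} (hφ : φ.IsExistential) :
    ∃ (m : ℕ) (h : n ≤ m) (ψ : L.BoundedFormula α m), ψ.IsQF ∧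
      ∀ (M : Type*) [L.Structure M] (v : α → M) (xs : Fin n → M),
        φ.Realize v xs ↔ ∃ w : Fin m → M, (∀ i, w (Fin.castLE h i) = xs i) ∧ ψ.Realize v w := by
  induction hφ with
  | @of_isQF n φ hφ =>
    refine ⟨n, le_rfl, φ, hφ, fun M _ v xs => ⟨fun h => ⟨xs, fun i => rfl, h⟩, ?_⟩⟩
    rintro ⟨w, hw, h⟩
    rwa [← show w = xs from funext hw]
  | @ex n φ _ ih =>
    obtain ⟨m, hm, ψ, hψ, ih⟩ := ih
    refine ⟨m, n.le_succ.trans hm, ψ, hψ, fun M _ v xs => ?_⟩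
    rw [BoundedFormula.realize_ex]
    constructor
    · rintro ⟨a, ha⟩
      obtain ⟨w, hw, h⟩ := (ih M v _).1 ha
      refine ⟨w, fun i => ?_, h⟩
      have := hw i.castSucc
      rwa [Fin.snoc_castSucc] at this
    · rintro ⟨w, hw, h⟩
      refine ⟨w (Fin.castLE hm (Fin.last n)), (ih M v _).2 ⟨w, fun i => ?_, h⟩⟩
      induction i using Fin.lastCases with
      | last => rw [Fin.snoc_last]
      | cast i => rw [Fin.snoc_castSucc, ← hw]; rfl

end Formulas

/-! ### Pieces of the generated subfield -/

/-- A rational expression whose numerator and denominator are values of one polynomial `g` at tuples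
from `X` lies in a piece of the generated subfield that depends only on `g`. -/
theorem mem_fieldPiece_of_forall {K σ : Type*} [Field K]
    {f : ℕ → MvPolynomial ℕ (⊥ : Subfield K)} (hf : IsPolynomialEnumeration K f) {X : Set K}
    (hX : X.Nonempty) (g : MvPolynomial σ (⊥ : Subfield K)) :
    ∃ m, ∀ (x : K) (a b : σ → K), (∀ i, a i ∈ X) → (∀ i, b i ∈ X) → MvPolynomial.aeval a g ≠ 0 →
      x * MvPolynomial.aeval a g = MvPolynomial.aeval b g → x ∈ fieldPiece f X m := by
  obtain ⟨N, e, -, g, rfl⟩ := g.exists_fin_rename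
  obtain ⟨i, hi⟩ := hf.surjective (MvPolynomial.rename Fin.val g)
  obtain ⟨x₀, hx₀⟩ := hX
  let ext : (σ → K) → ℕ → K := fun a l => if h : l < N then a (e ⟨l, h⟩) else x₀
  have hext : ∀ a : σ → K, MvPolynomial.aeval (ext a) (f i) =
      MvPolynomial.aeval a (MvPolynomial.rename e g) := fun a => by
    rw [hi, MvPolynomial.aeval_rename, MvPolynomial.aeval_rename]
    congr 2
    ext l
    simp [ext]
  have hmem : ∀ a : σ → K, (∀ i, a i ∈ X) → ∀ l, ext a l ∈ X := fun a ha l => by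
    simp only [ext]
    split_ifs
    exacts [ha _, hx₀]
  refine ⟨i + 1, fun x a b ha hb ha0 hx => ⟨ext a, ext b, fun l _ => hmem a ha l,
    fun l _ => hmem b hb l, i, i.lt_succ_self, i, i.lt_succ_self, ?_, ?_⟩⟩
  · rw [hext, hext, hx]
  · rwa [hext]

theorem exists_aeval_eq_of_mem_closure {K : Type*} [Field K] (X : Set K) {z : K}
    (hz : z ∈ Submonoid.closure X) :
    ∃ g : MvPolynomial X (⊥ : Subfield K), MvPolynomial.aeval ((↑) : X → K) g = z := by
  induction hz using Submonoid.closure_induction with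
  | mem x hx => exact ⟨MvPolynomial.X ⟨x, hx⟩, MvPolynomial.aeval_X _ _⟩
  | one => exact ⟨1, map_one _⟩
  | mul x y _ _ hx hy =>
    obtain ⟨g, rfl⟩ := hx
    obtain ⟨h, rfl⟩ := hy
    exact ⟨g * h, map_mul _ _ _⟩

/-- If all values near one point of the additive polynomial `∑ z_l y_l ^ q` are combinations of
elements of `X` with coefficients `z`, then a difference quotient of that polynomial writes every
`q`-th power as a rational function in elements of `X`, the same for all. -/
theorem exists_range_pow_subset_fieldPiece {K Γ₀ : Type*} [Field K]
    [LinearOrderedCommGroupWithZero Γ₀] [Valued K Γ₀] [NeBot (𝓝[≠] (0 : K))]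
    (p n : ℕ) [ExpChar K p]
    {f : ℕ → MvPolynomial ℕ (⊥ : Subfield K)} (hf : IsPolynomialEnumeration K f) {X : Set K}
    (hX : X.Nonempty) {r : ℕ} (z e : Fin r → K) (hz : ∀ k, z k ∈ Submonoid.closure X)
    (he : ∑ l, z l * e l ^ p ^ n = 1) (y₀ : Fin r → K)
    (h : ∀ᶠ y in 𝓝 y₀, ∃ x : Fin r → K, (∀ k, x k ∈ X) ∧
      ∑ k, z k * x k = ∑ l, z l * y l ^ p ^ n) :
    ∃ m, ∀ c : K, c ^ p ^ n ∈ fieldPiece f X m := by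
  choose Z hZ using fun k => exists_aeval_eq_of_mem_closure X (hz k)
  let g : MvPolynomial ((Fin r ⊕ Fin r) ⊕ X) (⊥ : Subfield K) :=
    ∑ k, MvPolynomial.rename Sum.inr (Z k) *
      (MvPolynomial.X (Sum.inl (Sum.inl k)) - MvPolynomial.X (Sum.inl (Sum.inr k)))
  let pt : (Fin r → K) → (Fin r → K) → ((Fin r ⊕ Fin r) ⊕ X) → K := fun x x' =>
    Sum.elim (Sum.elim x x') (↑)
  have hg : ∀ x x', MvPolynomial.aeval (pt x x') g = ∑ k, z k * x k - ∑ k, z k * x' k := by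
    intro x x'
    have hpt : pt x x' ∘ Sum.inr = ((↑) : X → K) := rfl
    simp only [g, map_sum, map_mul, map_sub, MvPolynomial.aeval_rename, MvPolynomial.aeval_X, hpt,
      hZ, mul_sub, Finset.sum_sub_distrib]
    rfl
  obtain ⟨m, hm⟩ := mem_fieldPiece_of_forall hf hX g
  refine ⟨m, fun c => ?_⟩
  have hline : ∀ d : K, ∀ᶠ ε in 𝓝 (0 : K), ∃ x : Fin r → K, (∀ k, x k ∈ X) ∧
      ∑ k, z k * x k = ∑ l, z l * (y₀ l + ε * d * e l) ^ p ^ n := by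
    intro d
    have hcont : Continuous fun (ε : K) (l : Fin r) => y₀ l + ε * d * e l := by fun_prop
    have ht := hcont.tendsto 0
    simp only [zero_mul, add_zero] at ht
    exact ht.eventually h
  obtain ⟨ε, hε, ⟨x₁, hx₁, h₁⟩, ⟨x₂, hx₂, h₂⟩⟩ :=
    ((eventually_mem_nhdsWithin (a := (0 : K)) (s := {0}ᶜ)).and
      (((hline 1).and (hline c)).filter_mono nhdsWithin_le_nhds)).exists
  obtain ⟨x₀, hx₀, h₀⟩ := h.self_of_nhds
  have hadd : ∀ d : K, ∑ l, z l * (y₀ l + ε * d * e l) ^ p ^ n -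
      ∑ l, z l * y₀ l ^ p ^ n = (ε * d) ^ p ^ n := by
    intro d
    simp only [add_pow_expChar_pow, mul_add, Finset.sum_add_distrib, add_sub_cancel_left]
    conv_rhs => rw [← mul_one ((ε * d) ^ p ^ n), ← he, Finset.mul_sum]
    refine Finset.sum_congr rfl fun l _ => ?_
    rw [mul_pow (ε * d)]
    ring
  have hpt : ∀ x x' : Fin r → K, (∀ k, x k ∈ X) → (∀ k, x' k ∈ X) → ∀ i, pt x x' i ∈ X := by
    rintro x x' hx hx' ((k | k) | s)
    exacts [hx k, hx' k, s.2]
  refine hm _ (pt x₁ x₀) (pt x₂ x₀) (hpt _ _ hx₁ hx₀) (hpt _ _ hx₂ hx₀) ?_ ?_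
  · rw [hg, h₁, h₀, hadd, mul_one]
    exact pow_ne_zero _ hε
  · rw [hg, hg, h₁, h₂, h₀, hadd, hadd, mul_one, mul_pow, mul_comm]

/-! ### Existentially definable sets -/

/-- The topology of a nontrivial valuation is not discrete. -/
theorem Valued.neBot_nhdsNE_zero {K Γ₀ : Type*} [Field K] [LinearOrderedCommGroupWithZero Γ₀]
    [Valued K Γ₀] (hv : (Valued.v : Valuation K Γ₀).IsNontrivial) : NeBot (𝓝[≠] (0 : K)) := by
  obtain ⟨x, hx0, hx1⟩ : ∃ x : K, x ≠ 0 ∧ (Valued.v x : Γ₀) < 1 := by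
    obtain ⟨x, hx0, hx1⟩ := hv.exists_val_nontrivial
    have hx : x ≠ 0 := fun h => hx0 (by rw [h, map_zero])
    rcases lt_or_gt_of_ne hx1 with h | h
    · exact ⟨x, hx, h⟩
    · exact ⟨x⁻¹, inv_ne_zero hx, by rw [map_inv₀]; exact inv_lt_one_of_one_lt₀ h⟩
  rw [← mem_closure_iff_nhdsWithin_neBot,
    mem_closure_iff_nhds_basis (Valued.hasBasis_nhds_zero K Γ₀)]
  intro γ _
  obtain ⟨a, b, ha, hb, hab⟩ := Valuation.exists_div_eq_of_unit Valued.v γ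
  have ha0 : a ≠ 0 := fun h => by simp [h] at ha
  have hb0 : b ≠ 0 := fun h => by simp [h] at hb
  refine ⟨x * (a / b), mul_ne_zero hx0 (div_ne_zero ha0 hb0), ?_⟩
  change (Valued.v : Valuation K Γ₀).restrict _ < _
  rw [← hab, ← map_div₀, Valuation.restrict_lt_iff, map_mul]
  refine mul_lt_of_lt_one_left ?_ hx1
  rw [map_div₀]
  exact div_pos ha hb

theorem mainTheorem3 {K : Type*} [Field K] [FirstOrder.Ring.CompatibleRing K]
    (p : ℕ) [ExpChar K p]
    {Γ₀ : Type*} [LinearOrderedCommGroupWithZero Γ₀] (v : Valuation K Γ₀)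
    (hv : v.IsNontrivial) (hens : HenselianLocalRing v.valuationSubring)
    (f : ℕ → MvPolynomial ℕ (⊥ : Subfield K)) (hf : IsPolynomialEnumeration K f)
    {k : ℕ} (φ : FirstOrder.Language.ring.Formula (Unit ⊕ Fin k))
    (hφ : FirstOrder.Language.BoundedFormula.IsExistential φ)
    (q : Fin k → K) (hX : (definedSet φ q).Infinite) :
    ∃ m n : ℕ, {y : K | ∃ x : K, y = x ^ p ^ n} ⊆ fieldPiece f (definedSet φ q) m := by
  let val : Valued K Γ₀ := Valued.mk' v
  have hens' : HenselianLocalRing (Valued.v : Valuation K Γ₀).valuationSubring := hens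
  have hne : NeBot (𝓝[≠] (0 : K)) := Valued.neBot_nhdsNE_zero (Γ₀ := Γ₀) hv
  obtain ⟨m, _, ψ, hψ, hφψ⟩ := hφ.exists_isQF
  have hdef : ∀ x : K, x ∈ definedSet φ q ↔
      ∃ w : Fin m → K, ψ.Realize (Sum.elim (fun _ => x) q) w := fun x => by
    refine (hφψ K _ default).trans (exists_congr fun w => ?_)
    exact ⟨fun h => h.2, fun h => ⟨fun i => i.elim0, h⟩⟩
  choose w hw using fun s : definedSet φ q => (hdef s).1 s.2
  have : Infinite (definedSet φ q) := hX.to_subtype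
  -- The formula speaks of the point, the constants `q`, and the witnesses.
  let σ : (Unit ⊕ Fin k) ⊕ Fin m → MvPolynomial (Unit ⊕ Fin m) K :=
    Sum.elim (Sum.elim (fun _ => MvPolynomial.X (Sum.inl ())) fun i => MvPolynomial.C (q i))
      fun i => MvPolynomial.X (Sum.inr i)
  have hσ₁ : ∀ x : Unit ⊕ Fin m → K, (fun a => MvPolynomial.eval x (σ (Sum.inl a))) =
      Sum.elim (fun _ => x (Sum.inl ())) q := fun x => by
    ext (a | a) <;> simp [σ]
  have hσ₂ : ∀ x : Unit ⊕ Fin m → K, (fun i => MvPolynomial.eval x (σ (Sum.inr i))) =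
      fun i => x (Sum.inr i) := fun x => by
    ext i; simp [σ]
  let ξ : Unit ⊕ Fin m → definedSet φ q → K := Sum.elim (fun _ s => s) fun i s => w s i
  obtain ⟨n, r, z, e, hz, he, y₀, fam, hsum, hfam⟩ :=
    exists_nearby_families p (definedSet φ q) ξ (Sum.inl ()) fun s => rfl
  have hmem : ∀ᶠ s in hyperfilter (definedSet φ q), ∀ i, ∀ᶠ y in 𝓝 (y₀ s),
      (fam i (Sum.inl ())).1 s y ∈ definedSet φ q := by
    refine eventually_all.2 fun i => ?_
    have h := FirstOrder.Ring.eventually_realize_iff_of_isQF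
      (hyperfilter (definedSet φ q) : Filter (definedSet φ q)) (fun s => 𝓝 (y₀ s))
      (fun s y b => (fam i b).1 s y) (fun s b => ξ b s) (hfam i) σ hψ
    filter_upwards [h] with s hs
    filter_upwards [hs] with y hy
    rw [hσ₁, hσ₁, hσ₂, hσ₂] at hy
    exact (hdef _).2 ⟨_, hy.2 (hw s)⟩
  obtain ⟨s, hs, hs'⟩ := (hsum.and hmem).exists
  obtain ⟨m', hm'⟩ := exists_range_pow_subset_fieldPiece (Γ₀ := Γ₀) p n hf hX.nonempty z e hz he
    (y₀ s) (by
      filter_upwards [hs, eventually_all.2 hs'] with y hy hy'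
      exact ⟨_, hy', hy⟩)
  exact ⟨m', n, by rintro _ ⟨c, rfl⟩; exact hm' c⟩
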